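/- Let $n\ge 1$, let $\Omega\subset\mathbb R^n$ be a bounded open set, and let $2\le p<\infty$, $1<q\le p$, $\sigma>0$. Let $\boldsymbol a:\Omega\times\mathbb R^n\to\mathbb R^n$ be a Carathéodory function (measurable in $x\in\Omega$, continuous in $\xi\in\mathbb R^n$) such that, for some constant $\gamma>0$, $$(\boldsymbol a(x,\xi)-\boldsymbol a(x,\eta))\cdot(\xi-\eta)\ \ge\ \gamma\,|\xi-\eta|^r\qquad\text{for all } x\in\Omega,\ \xi,\eta\in\mathbb R^n,\ r\in[\max(2,q),p].$$ Let $f,g:\Omega\times\mathbb R\to\mathbb R$ be continuous, with $f(x,t)$ and $g(x,t)$ non-decreasing in $t\in\mathbb R$ for every $x\in\Omega$, and write $$Qu:=-\operatorname{div}(\boldsymbol a(x,\nabla u))+f(x,u)+g(x,u)|\nabla u|^\sigma .$$ Suppose that either (I) $u,v\in W^{1,p}_{loc}(\Omega)\cap L^\infty_{loc}(\Omega)$, with $|\boldsymbol a(x,\nabla u)|,|\boldsymbol a(x,\nabla v)|\in L^{p/(p-1)}_{loc}(\Omega)$, and one of the following holds: - ($A_1$) $0<\sigma\le 1$, and $f$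 is strictly increasing in $t$; - ($A_{2a}$) $1\le\sigma\le\max(q,2)-1$, and $f$ and $g$ are strictly increasing in $t$; - ($A_{2b}$) $\max(q,2)-1\le\sigma\le p-1$, and $g$ is strictly increasing in $t$; - ($A_3$) $p-1\le\sigma\le p$, $g$ is strictly increasing in $t$, and $\operatorname{ess\,sup}_\Omega(u-v)<\infty$; or (II) $u,v\in W^{1,\infty}_{loc}(\Omega)$, with $|\boldsymbol a(x,\nabla u)|,|\boldsymbol a(x,\nabla v)|\in L^{1}_{loc}(\Omega)$, and - ($A_4$) $p\le\sigma$, and $g$ is strictly increasing in $t$. (Here "strictly increasing in $t$" means for every $x\in\Omega$.) If $Qu\le Qv$ in $\Omega$, that is, $$\int_\Omega(\boldsymbol a(x,\nabla u)-\boldsymbol a(x,\nabla v))\cdot\nabla\varphi\,dx\ \le\ \int_\Omega\big(f(x,v)+g(x,v)|\nabla v|^\sigma-f(x,u)-g(x,u)|\nabla u|^\sigma\big)\varphi\,dx$$ for all $\varphi\in C^1_c(\Omega)$ with $\varphi\ge0$, and $u\le v$ on $\partial\Omega$ in the sense that $\limsup_{x\to\partial\Omega}(u(x)-v(x))\le0$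 (for every $\varepsilon>0$ there is $\delta>0$ with $u-v\le\varepsilon$ a.e. on $\{x\in\Omega:\operatorname{dist}(x,\partial\Omega)<\delta\}$), then $u\le v$ a.e. in $\Omega$. -/

import Mathlib

open MeasureTheory Set
open scoped ENNReal ContDiff

/-- `F ∈ L^s_loc(Ω)`: `F` is `L^s` on every compact subset of `Ω`. -/
def MemLpLoc {n : ℕ} {Y : Type*} [NormedAddCommGroup Y]
    (Ω : Set (EuclideanSpace ℝ (Fin n))) (s : ℝ≥0∞) (F : EuclideanSpace ℝ (Fin n) → Y) : Prop :=
  ∀ K : Set (EuclideanSpace ℝ (Fin n)), IsCompact K → K ⊆ Ω → MemLp F s (volume.restrict K)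

/-- `Du` is a weak (distributional) gradient of `u` in `Ω`:
`∫_Ω u ∇φ = - ∫_Ω φ Du` for all `φ ∈ C_c^∞(Ω)`. -/
def IsWeakGradient {n : ℕ} (Ω : Set (EuclideanSpace ℝ (Fin n)))
    (u : EuclideanSpace ℝ (Fin n) → ℝ)
    (Du : EuclideanSpace ℝ (Fin n) → EuclideanSpace ℝ (Fin n)) : Prop :=
  ∀ φ : EuclideanSpace ℝ (Fin n) → ℝ, ContDiff ℝ ∞ φ → HasCompactSupport φ → tsupport φ ⊆ Ω →
    ∫ x in Ω, u x • gradient φ x = - ∫ x in Ω, φ x • Du x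

/-- `u ∈ W^{1,s}_loc(Ω)`, with weak gradient `Du` (which is unique up to null sets). -/
structure MemW1Loc {n : ℕ} (Ω : Set (EuclideanSpace ℝ (Fin n))) (s : ℝ≥0∞)
    (u : EuclideanSpace ℝ (Fin n) → ℝ)
    (Du : EuclideanSpace ℝ (Fin n) → EuclideanSpace ℝ (Fin n)) : Prop where
  memLp : MemLpLoc Ω s u
  memLp_grad : MemLpLoc Ω s Du
  weakGradient : IsWeakGradient Ω u Du

/-- A Carathéodory vector field on `Ω × ℝⁿ`: (Lebesgue) measurable in `x ∈ Ω`,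
continuous in `ξ`. -/
structure IsCaratheodory {n : ℕ} (Ω : Set (EuclideanSpace ℝ (Fin n)))
    (a : EuclideanSpace ℝ (Fin n) → EuclideanSpace ℝ (Fin n) → EuclideanSpace ℝ (Fin n)) :
    Prop where
  measurable : ∀ ξ, AEStronglyMeasurable (fun x => a x ξ) (volume.restrict Ω)
  continuous : ∀ x ∈ Ω, Continuous (a x)

/-- The ellipticity condition in the range `p ≥ 2`: one constant `γ > 0` serves all
exponents `r ∈ [max(2,q), p]`. -/
def IsEllipticField {n : ℕ} (Ω : Set (EuclideanSpace ℝ (Fin n))) (p q : ℝ)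
    (a : EuclideanSpace ℝ (Fin n) → EuclideanSpace ℝ (Fin n) → EuclideanSpace ℝ (Fin n)) :
    Prop :=
  ∃ γ : ℝ, 0 < γ ∧ ∀ r ∈ Icc (max 2 q) p, ∀ x ∈ Ω, ∀ ξ η : EuclideanSpace ℝ (Fin n),
    γ * ‖ξ - η‖ ^ r ≤ inner ℝ (a x ξ - a x η) (ξ - η)

/-- The special Hamiltonian `f(x,t) + g(x,t)|ξ|^σ`. -/
noncomputable def specialHamiltonian {n : ℕ} (f g : EuclideanSpace ℝ (Fin n) → ℝ → ℝ) (σ : ℝ)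
    (x : EuclideanSpace ℝ (Fin n)) (t : ℝ) (ξ : EuclideanSpace ℝ (Fin n)) : ℝ :=
  f x t + g x t * ‖ξ‖ ^ σ

/-- The weak inequality `Qu ≤ Qv` in `Ω` for `Qu = -div a(x,∇u) + H(x,u,∇u)`, tested against
all nonnegative `φ ∈ C^1_c(Ω)`; here `Du`, `Dv` are the weak gradients of `u`, `v`. -/
def QLe {n : ℕ} (Ω : Set (EuclideanSpace ℝ (Fin n)))
    (a : EuclideanSpace ℝ (Fin n) → EuclideanSpace ℝ (Fin n) → EuclideanSpace ℝ (Fin n))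
    (H : EuclideanSpace ℝ (Fin n) → ℝ → EuclideanSpace ℝ (Fin n) → ℝ)
    (u : EuclideanSpace ℝ (Fin n) → ℝ)
    (Du : EuclideanSpace ℝ (Fin n) → EuclideanSpace ℝ (Fin n))
    (v : EuclideanSpace ℝ (Fin n) → ℝ)
    (Dv : EuclideanSpace ℝ (Fin n) → EuclideanSpace ℝ (Fin n)) : Prop :=
  ∀ φ : EuclideanSpace ℝ (Fin n) → ℝ, ContDiff ℝ 1 φ → HasCompactSupport φ → tsupport φ ⊆ Ω →
    (∀ x, 0 ≤ φ x) →
    ∫ x in Ω, inner ℝ (a x (Du x) - a x (Dv x)) (gradient φ x) ≤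
      ∫ x in Ω, (H x (v x) (Dv x) - H x (u x) (Du x)) * φ x

/-- `u ≤ v` on `∂Ω`, i.e. `limsup_{x → ∂Ω} (u(x) - v(x)) ≤ 0`. As `u` and `v` are defined up to
null sets, this is the essential `limsup`, over `x ∈ Ω` with `dist(x, ∂Ω) → 0`. -/
def LeOnBoundary {n : ℕ} (Ω : Set (EuclideanSpace ℝ (Fin n)))
    (u v : EuclideanSpace ℝ (Fin n) → ℝ) : Prop :=
  ∀ ε : ℝ, 0 < ε → ∃ δ : ℝ, 0 < δ ∧
    ∀ᵐ x ∂(volume.restrict Ω), Metric.infDist x (frontier Ω) < δ → u x - v x ≤ ε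

/-! Put `w = u - v` and suppose that `w` exceeds some level `k₀ > 0` on a set of positive measure.
The boundary condition confines `{w > k₀}`, up to a null set, to a compact `K ⊆ Ω`. There `u` and
`v` are bounded, so `M = ess sup w` is finite and larger than `k₀`.

On `K ∩ {w ≥ k₀}` compactness turns strict monotonicity of `g` into a uniform gap between `g(x,u)`
and `g(x,v)`. The gap absorbs the separate powers of `|Du|` and `|Dv|` and leaves only `C|Dw|^σ`;
for `σ ≤ 1` subadditivity suffices and no gap is needed (`exists_specialHamiltonian_sub_le`). In
every case the difference of the Hamiltonians is then at most `C(|Dw|^(r-1) + |Dw|^r)` for an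
exponent `r` admissible in the ellipticity condition.

Testing with `(w-k)₊²` for `k₀ ≤ k < M` gives `2γ ∫ (w-k)₊ |Dw|^r ≤ C ∫ (|Dw|^(r-1) + |Dw|^r)
(w-k)₊²`. For `k` close to `M` the additional factor `(w-k)₊ ≤ M - k` absorbs the `|Dw|^r` term, and
Young's inequality reduces the other one to `∫ (w-k)₊^(r+1)` over `{k < w < M}`. The set `{w = M}`
may be omitted because `Dw = 0` a.e. on it, which follows from the energy inequality itself. The
measure of `{k < w < M}` tends to `0`, so the Sobolev inequality for `(w-k)₊^(r+1)` and a second use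
of Young bound that integral by a small multiple of the left-hand side. Hence the energy vanishes
and `w ≤ k < M` a.e., a contradiction (`exists_ae_le_lt_of_level_estimates`).

Admissible test functions are `C¹` with compact support, so powers of `(w-k)₊` have to be
approximated by mollification (`exists_test_approx`). Convergence of the gradients is measured by
pairing with a function in the dual space `L^(P')`. This treats `P = p` and `P = ∞` together,
although for `P = ∞` mollified gradients need not converge in norm. -/

/-! ### Elementary inequalities for powers -/

/-- A weighted Young inequality with an arbitrary small factor. -/
lemma exists_rpow_mul_rpow_le {α β : ℝ} (hα : 0 < α) (hβ : 0 < β) {ε : ℝ} (hε : 0 < ε) :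
    ∃ C : ℝ, 0 < C ∧ ∀ x y : ℝ, 0 ≤ x → 0 ≤ y →
      x ^ α * y ^ β ≤ ε * x ^ (α + β) + C * y ^ (α + β) := by
  -- The line `y = t x` separates the two regimes: below it `y ^ β ≤ ε x ^ β`, above it `x` is
  -- controlled by `y / t`.
  set t : ℝ := ε ^ (1 / β) with ht
  have ht0 : 0 < t := Real.rpow_pos_of_pos hε _
  have htβ : t ^ β = ε := by
    rw [ht, ← Real.rpow_mul hε.le, one_div_mul_cancel hβ.ne', Real.rpow_one]
  refine ⟨(1 / t) ^ α, by positivity, fun x y hx hy => ?_⟩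
  have hxx : 0 ≤ x ^ (α + β) := by positivity
  have hyy : 0 ≤ y ^ (α + β) := by positivity
  rcases le_total y (t * x) with h | h
  · have h1 : y ^ β ≤ t ^ β * x ^ β := by
      rw [← Real.mul_rpow ht0.le hx]
      exact Real.rpow_le_rpow hy h hβ.le
    have h2 : x ^ α * y ^ β ≤ ε * x ^ (α + β) := by
      rw [Real.rpow_add_of_nonneg hx hα.le hβ.le, ← htβ]
      calc x ^ α * y ^ β ≤ x ^ α * (t ^ β * x ^ β) := by gcongr
        _ = _ := by ring
    have : 0 ≤ (1 / t) ^ α * y ^ (α + β) := by positivity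
    linarith
  · have h0 : x ≤ 1 / t * y := by
      rw [one_div, ← div_eq_inv_mul, le_div_iff₀ ht0]
      linarith
    have h1 : x ^ α ≤ (1 / t) ^ α * y ^ α := by
      rw [← Real.mul_rpow (by positivity) hy]
      exact Real.rpow_le_rpow hx h0 hα.le
    have h2 : x ^ α * y ^ β ≤ (1 / t) ^ α * y ^ (α + β) := by
      rw [Real.rpow_add_of_nonneg hy hα.le hβ.le]
      calc x ^ α * y ^ β ≤ (1 / t) ^ α * y ^ α * y ^ β := by gcongr
        _ = _ := by ring
    have : 0 ≤ ε * x ^ (α + β) := by positivity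
    linarith

/-- The leading coefficient is arbitrarily close to `1`: if `e` is small relative to `m` then `m + e
≤ (1 + t) m`, and otherwise `m` is itself bounded by a multiple of `e`. -/
lemma exists_add_rpow_le {σ : ℝ} (hσ : 0 < σ) {ε : ℝ} (hε : 0 < ε) :
    ∃ C : ℝ, 0 < C ∧ ∀ m e : ℝ, 0 ≤ m → 0 ≤ e →
      (m + e) ^ σ ≤ (1 + ε) * m ^ σ + C * e ^ σ := by
  set t : ℝ := (1 + ε) ^ (1 / σ) - 1 with ht
  have ht0 : 0 < t := by
    have := Real.one_lt_rpow (by linarith : 1 < 1 + ε) (by positivity : 0 < 1 / σ)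
    linarith
  have htσ : (1 + t) ^ σ = 1 + ε := by
    rw [ht, add_sub_cancel, ← Real.rpow_mul (by positivity), one_div_mul_cancel hσ.ne',
      Real.rpow_one]
  refine ⟨(1 / t + 1) ^ σ, by positivity, fun m e hm he => ?_⟩
  rcases le_total e (t * m) with h | h
  · have h1 : (m + e) ^ σ ≤ (1 + ε) * m ^ σ := by
      rw [← htσ, ← Real.mul_rpow (by positivity) hm]
      exact Real.rpow_le_rpow (by positivity) (by linarith) hσ.le
    have : 0 ≤ (1 / t + 1) ^ σ * e ^ σ := by positivity
    linarith
  · have h0 : m ≤ 1 / t * e := by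
      rw [one_div, ← div_eq_inv_mul, le_div_iff₀ ht0]
      linarith
    have h1 : (m + e) ^ σ ≤ (1 / t + 1) ^ σ * e ^ σ := by
      rw [← Real.mul_rpow (by positivity) he]
      exact Real.rpow_le_rpow (by positivity) (by linarith) hσ.le
    have : 0 ≤ (1 + ε) * m ^ σ := by positivity
    linarith

/-! ### Sobolev inequality on small sets and the level-set argument -/

/-- On an arbitrary set `A`, the integral of a compactly supported `C¹` function is controlled by
`|A|^{1/n}` times the `L¹` norm of its derivative. -/
lemma exists_setLIntegral_le_lintegral_fderiv {n : ℕ} (hn : 0 < n) :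
    ∃ C : ℝ≥0∞, C ≠ ⊤ ∧ ∀ Y : EuclideanSpace ℝ (Fin n) → ℝ, ContDiff ℝ 1 Y →
      HasCompactSupport Y → ∀ A : Set (EuclideanSpace ℝ (Fin n)),
        ∫⁻ x in A, ‖Y x‖ₑ ≤ C * volume A ^ (1 / (n : ℝ)) * ∫⁻ x, ‖fderiv ℝ Y x‖ₑ := by
  -- The Sobolev exponent `n / (n - 1)` degenerates for `n = 1`, where the sup norm is bounded
  -- directly by the integral of the derivative.
  rcases (Nat.succ_le_of_lt hn).eq_or_lt with h1 | h1
  · obtain rfl : n = 1 := h1.symm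
    refine ⟨1, ENNReal.one_ne_top, fun Y hY hYc A => ?_⟩
    let e : ℝ ≃ₗᵢ[ℝ] EuclideanSpace ℝ (Fin 1) := (OrthonormalBasis.singleton (Fin 1) ℝ).repr
    have he : MeasurePreserving e volume volume := e.measurePreserving
    have hsup : ∀ x, ‖Y x‖ₑ ≤ ∫⁻ x, ‖fderiv ℝ Y x‖ₑ := by
      intro x
      obtain ⟨t, rfl⟩ := e.surjective x
      have hc : ContDiff ℝ 1 (Y ∘ e) := hY.comp e.toContinuousLinearEquiv.contDiff
      have hcc : HasCompactSupport (Y ∘ e) := hYc.comp_homeomorph e.toHomeomorph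
      have hder : ∀ s, ‖deriv (Y ∘ e) s‖ₑ ≤ ‖fderiv ℝ Y (e s)‖ₑ := by
        intro s
        have h := ((hY.differentiable one_ne_zero (e s)).hasFDerivAt.comp_hasDerivAt s
          (e.toContinuousLinearEquiv.hasFDerivAt (x := s)).hasDerivAt)
        have h' : deriv (Y ∘ e) s = fderiv ℝ Y (e s) (e 1) := h.deriv
        rw [h', enorm_le_iff_norm_le]
        refine (ContinuousLinearMap.le_opNorm _ _).trans ?_
        rw [e.norm_map, norm_one, mul_one]
      calc ‖Y (e t)‖ₑ ≤ ∫⁻ s in Iic t, ‖deriv (Y ∘ e) s‖ₑ :=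
            hcc.enorm_le_lintegral_Ici_deriv hc t
        _ ≤ ∫⁻ s, ‖deriv (Y ∘ e) s‖ₑ := setLIntegral_le_lintegral _ _
        _ ≤ ∫⁻ s, ‖fderiv ℝ Y (e s)‖ₑ := lintegral_mono hder
        _ = ∫⁻ x, ‖fderiv ℝ Y x‖ₑ := by
            refine he.lintegral_comp (f := fun x => ‖fderiv ℝ Y x‖ₑ) ?_
            exact (hY.continuous_fderiv one_ne_zero).measurable.enorm
    calc ∫⁻ x in A, ‖Y x‖ₑ ≤ ∫⁻ x in A, (∫⁻ x, ‖fderiv ℝ Y x‖ₑ) := lintegral_mono hsup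
      _ = _ := by simp [mul_comm]
  · have hconj : Real.HolderConjugate (n : ℝ) (Real.conjExponent n) :=
      Real.HolderConjugate.conjExponent (by exact_mod_cast h1)
    set κ := Real.conjExponent (n : ℝ) with hκ
    have hconj' : Real.HolderConjugate
        (Module.finrank ℝ (EuclideanSpace ℝ (Fin n)) : ℝ) κ := by simpa using hconj
    have hκ0 : 0 < κ := hconj.symm.pos
    set C := lintegralPowLePowLIntegralFDerivConst
      (volume : Measure (EuclideanSpace ℝ (Fin n))) κ
    refine ⟨(C : ℝ≥0∞) ^ (1 / κ), ENNReal.rpow_ne_top_of_nonneg (by positivity)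
      ENNReal.coe_ne_top, fun Y hY hYc A => ?_⟩
    -- Gagliardo–Nirenberg–Sobolev in `L^(n/(n-1))`, then Hölder against the constant `1` on `A`,
    -- which produces the factor `|A|^(1/n)`.
    have hS := lintegral_pow_le_pow_lintegral_fderiv
      (volume : Measure (EuclideanSpace ℝ (Fin n))) hY hYc hconj'
    have hH := ENNReal.lintegral_mul_le_Lp_mul_Lq (volume.restrict A) hconj
      (f := fun _ => 1) (g := fun x => ‖Y x‖ₑ) aemeasurable_const
      hY.continuous.measurable.enorm.aemeasurable
    simp only [Pi.mul_apply, one_mul, ENNReal.one_rpow, lintegral_const, Measure.restrict_apply,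
      MeasurableSet.univ, univ_inter] at hH
    calc ∫⁻ x in A, ‖Y x‖ₑ ≤ volume A ^ (1 / (n : ℝ)) *
          (∫⁻ x in A, ‖Y x‖ₑ ^ κ) ^ (1 / κ) := hH
      _ ≤ volume A ^ (1 / (n : ℝ)) * (C * (∫⁻ x, ‖fderiv ℝ Y x‖ₑ) ^ κ) ^ (1 / κ) := by
          gcongr
          exact (setLIntegral_le_lintegral _ _).trans hS
      _ = _ := by
          rw [ENNReal.mul_rpow_of_nonneg _ _ (by positivity), ← ENNReal.rpow_mul,
            mul_one_div_cancel hκ0.ne', ENNReal.rpow_one]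
          ring

-- The strict upper bound `w < M` is essential: it makes the intersection of the decreasing sets
-- empty, whereas `{w = M}` may have positive measure.
open Filter Topology in
lemma tendsto_measureReal_levels {X : Type*} [MeasurableSpace X] (μ : Measure X)
    [IsFiniteMeasure μ] {w : X → ℝ} (hw : AEMeasurable w μ) (M : ℝ) :
    Tendsto (fun j : ℕ => μ.real {x | M - 1 / ((j : ℝ) + 1) < w x ∧ w x < M}) atTop (𝓝 0) := by
  have hempty : (⋂ j : ℕ, {x | M - 1 / ((j : ℝ) + 1) < w x ∧ w x < M}) = ∅ := by
    ext x
    simp only [mem_iInter, mem_ofPred_eq, mem_empty_iff_false, iff_false, not_forall]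
    by_contra! h
    obtain ⟨j, hj⟩ := exists_nat_one_div_lt (sub_pos.2 (h 0).2)
    linarith [(h j).1]
  have h := tendsto_measure_iInter_atTop (μ := μ)
    (s := fun j : ℕ => {x | M - 1 / ((j : ℝ) + 1) < w x ∧ w x < M})
    (fun j => (nullMeasurableSet_lt aemeasurable_const hw).inter
      (nullMeasurableSet_lt hw aemeasurable_const)) ?_ ⟨0, measure_ne_top _ _⟩
  · rw [hempty, measure_empty] at h
    exact (ENNReal.tendsto_toReal ENNReal.zero_ne_top).comp h
  · intro i j hij x hx
    refine ⟨lt_of_le_of_lt ?_ hx.1, hx.2⟩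
    have : 1 / ((j : ℝ) + 1) ≤ 1 / ((i : ℝ) + 1) := by gcongr
    linarith

/-- The level-set argument: an energy inequality at all levels close to the maximum `M` of `w`,
combined with a Sobolev inequality which is effective on small sets, shows that the values of `w`
stay away from `M`. -/
lemma exists_ae_le_lt_of_level_estimates {X : Type*} [MeasurableSpace X] (μ : Measure X)
    [IsFiniteMeasure μ] {w d : X → ℝ} {r k₀ M c S θ : ℝ} (hr : 1 < r) (hw : AEMeasurable w μ)
    (hd : AEMeasurable d μ) (hd0 : ∀ x, 0 ≤ d x) (hdr : Integrable (fun x => d x ^ r) μ)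
    (hwM : ∀ᵐ x ∂μ, w x ≤ M) (hk₀ : k₀ < M) (hc : 0 < c) (hS0 : 0 ≤ S) (hθ : 0 < θ)
    (henergy : ∀ k, k₀ ≤ k → k < M → c * ∫ x, max (w x - k) 0 * d x ^ r ∂μ ≤
      ∫ x, (d x ^ (r - 1) + d x ^ r) * max (w x - k) 0 ^ 2 ∂μ)
    (hsob : ∀ k, k₀ ≤ k → k < M → ∀ A : Set X, ∫ x in A, max (w x - k) 0 ^ (r + 1) ∂μ ≤
      S * μ.real A ^ θ * ∫ x, max (w x - k) 0 ^ r * d x ∂μ) :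
    ∃ k, k₀ ≤ k ∧ k < M ∧ ∀ᵐ x ∂μ, w x ≤ k := by
  have hs0 : ∀ k x, 0 ≤ max (w x - k) 0 := fun k x => le_max_right _ _
  have hsM : ∀ k, k < M → ∀ᵐ x ∂μ, max (w x - k) 0 ≤ M - k := by
    intro k hk
    filter_upwards [hwM] with x hx
    exact max_le (by linarith) (by linarith)
  have hdle : ∀ β, 0 ≤ β → β ≤ r → ∀ x, d x ^ β ≤ 1 + d x ^ r := by
    intro β h0 hβ x
    have := Real.rpow_nonneg (hd0 x) r
    rcases le_total (d x) 1 with h | h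
    · linarith [Real.rpow_le_one (hd0 x) h h0]
    · linarith [Real.rpow_le_rpow_of_exponent_le h hβ]
  have hint : ∀ k, k < M → ∀ α β : ℝ, 0 ≤ α → 0 ≤ β → β ≤ r →
      Integrable (fun x => max (w x - k) 0 ^ α * d x ^ β) μ := by
    intro k hk α β hα h0 hβ
    refine Integrable.mono' (((integrable_const (1 : ℝ)).add hdr).const_mul ((M - k) ^ α))
      (AEMeasurable.aestronglyMeasurable (by fun_prop)) ?_
    filter_upwards [hsM k hk] with x hx
    have h1 := Real.rpow_nonneg (hs0 k x) α
    have h2 := Real.rpow_nonneg (hd0 x) β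
    rw [Real.norm_of_nonneg (mul_nonneg h1 h2)]
    exact mul_le_mul (Real.rpow_le_rpow (hs0 k x) hx hα) (hdle β h0 hβ x) h2
      (Real.rpow_nonneg (by linarith) _)
  have hintβ : ∀ β, 0 ≤ β → β ≤ r → Integrable (fun x => d x ^ β) μ := by
    intro β h0 hβ
    simpa using hint k₀ hk₀ 0 β le_rfl h0 hβ
  -- `d` vanishes on the top level set
  have htop : ∀ᵐ x ∂μ, w x = M → d x = 0 := by
    have hZ : NullMeasurableSet {x | w x = M} μ := nullMeasurableSet_eq_fun hw aemeasurable_const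
    set I := ∫ x in {x | w x = M}, d x ^ r ∂μ with hI
    set J := ∫ x, (d x ^ (r - 1) + d x ^ r) ∂μ with hJ
    have hI0 : 0 ≤ I := integral_nonneg fun x => Real.rpow_nonneg (hd0 x) r
    have hJint : Integrable (fun x => d x ^ (r - 1) + d x ^ r) μ :=
      (hintβ (r - 1) (by linarith) (by linarith)).add hdr
    have hJ0 : 0 ≤ J := integral_nonneg fun x =>
      add_nonneg (Real.rpow_nonneg (hd0 x) _) (Real.rpow_nonneg (hd0 x) _)
    -- On `{w = M}` the truncation equals `M - k`, so the left side of the energy inequality is of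
    -- order `M - k` while the right side is of order `(M - k)²`. Dividing by `M - k` and letting
    -- `k` tend to `M` forces `I = 0`.
    have hle : ∀ k, k₀ ≤ k → k < M → c * I ≤ (M - k) * J := by
      intro k hk hkM
      have hpos : 0 < M - k := by linarith
      have hE := hint k hkM 1 r zero_le_one (by linarith) le_rfl
      simp only [Real.rpow_one] at hE
      have h1 : (M - k) * I ≤ ∫ x, max (w x - k) 0 * d x ^ r ∂μ := by
        rw [hI, ← integral_const_mul]
        calc ∫ x in {x | w x = M}, (M - k) * d x ^ r ∂μ
            = ∫ x in {x | w x = M}, max (w x - k) 0 * d x ^ r ∂μ := by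
              refine setIntegral_congr_ae₀ hZ (Filter.Eventually.of_forall fun x hx => ?_)
              have : w x = M := hx
              simp only [this, max_eq_left hpos.le]
          _ ≤ _ := setIntegral_le_integral hE (Filter.Eventually.of_forall fun x =>
              mul_nonneg (hs0 k x) (Real.rpow_nonneg (hd0 x) r))
      have h2 : ∫ x, (d x ^ (r - 1) + d x ^ r) * max (w x - k) 0 ^ 2 ∂μ ≤ (M - k) ^ 2 * J := by
        rw [hJ, ← integral_const_mul]
        refine integral_mono_of_nonneg (Filter.Eventually.of_forall fun x => ?_)
          (hJint.const_mul _) ?_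
        · exact mul_nonneg (add_nonneg (Real.rpow_nonneg (hd0 x) _) (Real.rpow_nonneg (hd0 x) _))
            (sq_nonneg _)
        · filter_upwards [hsM k hkM] with x hx
          rw [mul_comm]
          have := hs0 k x
          have := add_nonneg (Real.rpow_nonneg (hd0 x) (r - 1)) (Real.rpow_nonneg (hd0 x) r)
          gcongr
      have h3 := henergy k hk hkM
      have h4 : (M - k) * (c * I) ≤ (M - k) * ((M - k) * J) := by nlinarith
      exact le_of_mul_le_mul_left h4 hpos
    have hIz : I = 0 := by
      by_contra hne
      have hIpos : 0 < c * I := mul_pos hc (lt_of_le_of_ne hI0 (Ne.symm hne))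
      -- This choice makes `η J ≤ c I / 2`, against `c I ≤ η J`.
      set η := min (M - k₀) (c * I / (2 * (J + 1))) with hη
      have hη0 : 0 < η := lt_min (by linarith) (by positivity)
      have h := hle (M - η) (by linarith [min_le_left (M - k₀) (c * I / (2 * (J + 1)))])
        (by linarith)
      have h' : η ≤ c * I / (2 * (J + 1)) := min_le_right _ _
      rw [le_div_iff₀ (by positivity)] at h'
      nlinarith
    have := (setIntegral_eq_zero_iff_of_nonneg_ae
      (Filter.Eventually.of_forall fun x => Real.rpow_nonneg (hd0 x) r) hdr.integrableOn).1 hIz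
    rw [Filter.EventuallyEq, ae_restrict_iff'₀ hZ] at this
    filter_upwards [this] with x hx hxM
    exact ((Real.rpow_eq_zero (hd0 x) (by linarith)).1 (hx hxM))
  -- The value `c / 4`, together with `M - k ≤ c / 4` below, lets half of the energy be absorbed.
  -- The value `1 / (2 (m + 1))` will absorb half of `D`. The constant `m` uses the total mass, so
  -- that `C₁` and `C₂` are fixed before `k` is chosen.
  obtain ⟨C₁, hC₁, hY₁⟩ := exists_rpow_mul_rpow_le (α := r - 1) (β := 1) (by linarith)
    one_pos (ε := c / 4) (by positivity)
  set m := S * μ.real univ ^ θ with hm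
  have hm0 : 0 ≤ m := by positivity
  obtain ⟨C₂, hC₂, hY₂⟩ := exists_rpow_mul_rpow_le (α := r - 1) (β := 1) (by linarith)
    one_pos (ε := 1 / (2 * (m + 1))) (by positivity)
  simp only [sub_add_cancel, Real.rpow_one] at hY₁ hY₂
  obtain ⟨k, hk, hkM, hkc, hkA⟩ : ∃ k, k₀ ≤ k ∧ k < M ∧ M - k ≤ c / 4 ∧
      C₁ * S * (2 * C₂) * μ.real {x | k < w x ∧ w x < M} ^ θ ≤ c / 4 := by
    have h1 := (((tendsto_measureReal_levels μ hw M).rpow_const (p := θ)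
      (Or.inr hθ.le)).const_mul (C₁ * S * (2 * C₂)))
    rw [Real.zero_rpow hθ.ne', mul_zero] at h1
    have h2 := tendsto_one_div_add_atTop_nhds_zero_nat (𝕜 := ℝ)
    obtain ⟨j, hj1, hj2, hj3⟩ := ((h1.eventually_le_const (by positivity : 0 < c / 4)).and
      ((h2.eventually_le_const (by positivity : 0 < c / 4)).and
      (h2.eventually_le_const (sub_pos.2 hk₀)))).exists
    have : (0 : ℝ) < 1 / ((j : ℝ) + 1) := by positivity
    exact ⟨M - 1 / ((j : ℝ) + 1), by linarith, by linarith, by linarith, hj1⟩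
  refine ⟨k, hk, hkM, ?_⟩
  set A := {x | k < w x ∧ w x < M} with hA
  have hAm : NullMeasurableSet A μ := (nullMeasurableSet_lt aemeasurable_const hw).inter
      (nullMeasurableSet_lt hw aemeasurable_const)
  set s : X → ℝ := fun x => max (w x - k) 0 with hsdef
  set E := ∫ x, s x * d x ^ r ∂μ with hE
  set D := ∫ x, s x ^ r * d x ∂μ with hD
  have hEint : Integrable (fun x => s x * d x ^ r) μ := by
    simpa using hint k hkM 1 r zero_le_one (by linarith) le_rfl
  have hDint : Integrable (fun x => s x ^ r * d x) μ := by
    simpa using hint k hkM r 1 (by linarith) zero_le_one (by linarith)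
  have hNint : Integrable (fun x => s x ^ (r + 1)) μ := by
    simpa using hint k hkM (r + 1) 0 (by linarith) le_rfl (by linarith)
  -- Absorption in the energy inequality. Off `A` the right-hand integrand vanishes, since either
  -- the truncation is `0` or `w = M` and `d = 0`.
  have hE1 : c / 2 * E ≤ C₁ * ∫ x in A, s x ^ (r + 1) ∂μ := by
    have h := henergy k hk hkM
    have hb : ∫ x, (d x ^ (r - 1) + d x ^ r) * s x ^ 2 ∂μ ≤
        ∫ x, (c / 2 * (s x * d x ^ r) + C₁ * A.indicator (fun x => s x ^ (r + 1)) x) ∂μ := by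
      refine integral_mono_of_nonneg (Filter.Eventually.of_forall fun x => ?_)
        ((hEint.const_mul _).add ((hNint.indicator₀ hAm).const_mul _)) ?_
      · exact mul_nonneg (add_nonneg (Real.rpow_nonneg (hd0 x) _) (Real.rpow_nonneg (hd0 x) _))
            (sq_nonneg _)
      · filter_upwards [hsM k hkM, htop, hwM] with x hx hxt hxM
        have hsx : 0 ≤ s x := hs0 k x
        have hdr0 := Real.rpow_nonneg (hd0 x) r
        have hdr1 := Real.rpow_nonneg (hd0 x) (r - 1)
        have hind : 0 ≤ A.indicator (fun x => s x ^ (r + 1)) x :=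
          indicator_nonneg (fun x _ => Real.rpow_nonneg (hs0 k x) _) x
        by_cases hxA : x ∈ A
        · rw [indicator_of_mem hxA]
          have h1 := hY₁ (d x) (s x) (hd0 x) hsx
          have h2 : s x ≤ c / 4 := hx.trans hkc
          have h3 : s x ^ (r + 1) = s x ^ r * s x := by
            rw [Real.rpow_add_of_nonneg hsx (by linarith) zero_le_one, Real.rpow_one]
          rw [h3]
          calc (d x ^ (r - 1) + d x ^ r) * s x ^ 2
              = (d x ^ (r - 1) * s x) * s x + (d x ^ r * s x) * s x := by ring
            _ ≤ (c / 4 * d x ^ r + C₁ * s x ^ r) * s x + (d x ^ r * s x) * (c / 4) := by gcongr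
            _ = _ := by ring
        · have hz : (d x ^ (r - 1) + d x ^ r) * s x ^ 2 = 0 := by
            by_cases hkx : k < w x
            · have hxe : w x = M := by
                by_contra hne
                exact hxA ⟨hkx, lt_of_le_of_ne hxM hne⟩
              rw [hxt hxe, Real.zero_rpow (by linarith), Real.zero_rpow (by linarith)]
              simp
            · have : s x = 0 := max_eq_right (by linarith)
              simp [this]
          exact hz.le.trans (by positivity)
    rw [integral_add (hEint.const_mul _) ((hNint.indicator₀ hAm).const_mul _),
      integral_const_mul, integral_const_mul, integral_indicator₀ hAm] at hb
    have h' : c * E ≤ c / 2 * E + C₁ * ∫ x in A, s x ^ (r + 1) ∂μ := h.trans hb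
    linarith
  -- Young's inequality applied to `s ^ (r - 1) * d`, multiplied by `s`; the `s ^ (r + 1)` term
  -- returns to `D` through the Sobolev inequality on the whole space.
  have hD1 : D ≤ 2 * C₂ * E := by
    have hN : ∫ x, s x ^ (r + 1) ∂μ ≤ m * D := by
      have := hsob k hk hkM univ
      rwa [setIntegral_univ] at this
    have hb : D ≤ ∫ x, (1 / (2 * (m + 1)) * s x ^ (r + 1) + C₂ * (s x * d x ^ r)) ∂μ := by
      refine integral_mono hDint ((hNint.const_mul _).add (hEint.const_mul _)) fun x => ?_
      have hsx : 0 ≤ s x := hs0 k x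
      have h1 := hY₂ (s x) (d x) hsx (hd0 x)
      have h3 : s x ^ (r + 1) = s x ^ r * s x := by
        rw [Real.rpow_add_of_nonneg hsx (by linarith) zero_le_one, Real.rpow_one]
      have h4 : s x ^ r = s x ^ (r - 1) * s x := by
        conv_lhs => rw [← sub_add_cancel r 1]
        rw [Real.rpow_add_of_nonneg hsx (by linarith) zero_le_one, Real.rpow_one]
      calc s x ^ r * d x = (s x ^ (r - 1) * d x) * s x := by rw [h4]; ring
        _ ≤ (1 / (2 * (m + 1)) * s x ^ r + C₂ * d x ^ r) * s x := by gcongr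
        _ = _ := by rw [h3]; ring
    rw [integral_add (hNint.const_mul _) (hEint.const_mul _), integral_const_mul,
      integral_const_mul] at hb
    have hD0 : 0 ≤ D := integral_nonneg fun x =>
      mul_nonneg (Real.rpow_nonneg (hs0 k x) _) (hd0 x)
    have h5 : 1 / (2 * (m + 1)) * ∫ x, s x ^ (r + 1) ∂μ ≤ D / 2 := by
      rw [one_div, ← div_eq_inv_mul, div_le_iff₀ (by positivity)]
      nlinarith
    have h6 : ∫ x, s x * d x ^ r ∂μ = E := rfl
    rw [h6] at hb
    linarith
  have hE0 : 0 ≤ E := integral_nonneg fun x =>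
    mul_nonneg (hs0 k x) (Real.rpow_nonneg (hd0 x) _)
  -- Sobolev on the small set `A` closes the loop: `c / 2 * E ≤ c / 4 * E`.
  have hEz : E ≤ 0 := by
    have h1 := hsob k hk hkM A
    have h2 : C₁ * ∫ x in A, s x ^ (r + 1) ∂μ ≤ c / 4 * E := by
      calc C₁ * ∫ x in A, s x ^ (r + 1) ∂μ ≤ C₁ * (S * μ.real A ^ θ * D) := by gcongr
        _ ≤ C₁ * (S * μ.real A ^ θ * (2 * C₂ * E)) := by gcongr
        _ = (C₁ * S * (2 * C₂) * μ.real A ^ θ) * E := by ring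
        _ ≤ _ := by gcongr
    nlinarith
  have hNz : ∫ x, s x ^ (r + 1) ∂μ ≤ 0 := by
    have h1 := hsob k hk hkM univ
    rw [setIntegral_univ] at h1
    have hDz : D ≤ 0 := by nlinarith
    exact h1.trans (mul_nonpos_of_nonneg_of_nonpos hm0 hDz)
  have hNz' := (integral_eq_zero_iff_of_nonneg (fun x => Real.rpow_nonneg (hs0 k x) _) hNint).1
    (le_antisymm hNz (integral_nonneg fun x => Real.rpow_nonneg (hs0 k x) _))
  filter_upwards [hNz'] with x hx
  have : s x = 0 := (Real.rpow_eq_zero (hs0 k x) (by linarith)).1 hx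
  have h' : w x - k ≤ s x := le_max_left _ _
  linarith

lemma MeasureTheory.MemLp.ae_norm_le_toReal {X Y : Type*} [MeasurableSpace X] {μ : Measure X}
    [NormedAddCommGroup Y] {F : X → Y} (h : MemLp F ⊤ μ) :
    ∀ᵐ x ∂μ, ‖F x‖ ≤ (eLpNorm F ⊤ μ).toReal := by
  filter_upwards [ae_le_eLpNormEssSup (f := F) (μ := μ)] with x hx
  rw [eLpNorm_exponent_top, ← toReal_enorm]
  exact ENNReal.toReal_mono (by simpa using h.2.ne) hx

/-! ### Mollification in `L^P` and convergence against dual functions -/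

section Mollification

open Filter Topology ContinuousLinearMap
open scoped Convolution

variable {G V : Type*} [NormedAddCommGroup G] [InnerProductSpace ℝ G] [FiniteDimensional ℝ G]
  [MeasurableSpace G] [BorelSpace G] [NormedAddCommGroup V] [NormedSpace ℝ V]

lemma ContDiffBump.lintegral_enorm_normed (φ : ContDiffBump (0 : G)) :
    ∫⁻ t, ‖φ.normed volume t‖ₑ = 1 := by
  have h := ofReal_integral_norm_eq_lintegral_enorm (φ.integrable_normed (μ := volume))
  rw [← h]
  simp only [Real.norm_of_nonneg (φ.nonneg_normed _), φ.integral_normed, ENNReal.ofReal_one]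

lemma ContDiffBump.enorm_convolution_le (φ : ContDiffBump (0 : G)) (F : G → V) (x : G) :
    ‖(φ.normed volume ⋆[lsmul ℝ ℝ, volume] F : G → V) x‖ₑ ≤
      ∫⁻ t, ‖φ.normed volume t‖ₑ * ‖F (x - t)‖ₑ := by
  rw [convolution_lsmul]
  refine (enorm_integral_le_lintegral_enorm _).trans_eq ?_
  simp only [enorm_smul]

lemma ContDiffBump.norm_convolution_le (φ : ContDiffBump (0 : G)) {F : G → V} {R : ℝ}
    (hR : 0 ≤ R) (hF : ∀ᵐ y, ‖F y‖ ≤ R) (x : G) :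
    ‖(φ.normed volume ⋆[lsmul ℝ ℝ, volume] F : G → V) x‖ ≤ R := by
  have h : ‖(φ.normed volume ⋆[lsmul ℝ ℝ, volume] F : G → V) x‖ₑ ≤ ENNReal.ofReal R := by
    refine (φ.enorm_convolution_le F x).trans ?_
    have hF' : ∀ᵐ t, ‖F (x - t)‖ ≤ R :=
      (quasiMeasurePreserving_sub_left_of_right_invariant volume x).ae hF
    calc ∫⁻ t, ‖φ.normed volume t‖ₑ * ‖F (x - t)‖ₑ
        ≤ ∫⁻ t, ‖φ.normed volume t‖ₑ * ENNReal.ofReal R := by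
          refine lintegral_mono_ae ?_
          filter_upwards [hF'] with t ht
          gcongr
          rw [← ofReal_norm]
          exact ENNReal.ofReal_le_ofReal ht
      _ = ENNReal.ofReal R := by
          rw [lintegral_mul_const _ φ.continuous_normed.measurable.enorm,
            φ.lintegral_enorm_normed, one_mul]
  rw [← ofReal_norm] at h
  exact (ENNReal.ofReal_le_ofReal_iff hR).1 h

/-- Convolution with a normed bump function is a contraction of `L^P`. -/
lemma ContDiffBump.eLpNorm_convolution_le (φ : ContDiffBump (0 : G)) {F : G → V} {P : ℝ≥0∞}
    (hP1 : 1 ≤ P) (hPt : P ≠ ⊤) (hF : AEStronglyMeasurable F volume) :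
    eLpNorm (φ.normed volume ⋆[lsmul ℝ ℝ, volume] F : G → V) P volume ≤ eLpNorm F P volume := by
  obtain ⟨F', hF', hFF'⟩ := hF
  rw [convolution_congr (μ := volume) (lsmul ℝ ℝ) (Filter.EventuallyEq.refl _ _) hFF',
    eLpNorm_congr_ae hFF']
  have hP0 : P ≠ 0 := (zero_lt_one.trans_le hP1).ne'
  have hp1 : 1 ≤ P.toReal := by
    rw [← ENNReal.toReal_one]
    exact ENNReal.toReal_mono hPt hP1
  set p := P.toReal
  have hp0 : 0 < p := by linarith
  set ρ : G → ℝ≥0∞ := fun t => ‖φ.normed volume t‖ₑ with hρ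
  have hρm : Measurable ρ := φ.continuous_normed.measurable.enorm
  -- The kernel has mass one, so convolution is an average over the probability measure `ν`;
  -- monotonicity of `L^p` norms under `ν` (Jensen) and Tonelli give the contraction.
  set ν : Measure G := volume.withDensity ρ with hν
  have : IsProbabilityMeasure ν := ⟨by
    rw [hν, withDensity_apply _ MeasurableSet.univ, setLIntegral_univ, φ.lintegral_enorm_normed]⟩
  have hFm : Measurable fun z : G × G => ‖F' (z.1 - z.2)‖ₑ :=
    (hF'.comp_measurable (measurable_fst.sub measurable_snd)).enorm
  rw [eLpNorm_eq_lintegral_rpow_enorm_toReal hP0 hPt,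
    eLpNorm_eq_lintegral_rpow_enorm_toReal hP0 hPt]
  gcongr 1
  calc ∫⁻ x, ‖(φ.normed volume ⋆[lsmul ℝ ℝ, volume] F' : G → V) x‖ₑ ^ p
      ≤ ∫⁻ x, ∫⁻ t, ‖F' (x - t)‖ₑ ^ p ∂ν := by
        refine lintegral_mono fun x => ?_
        have hm : Measurable fun t => ‖F' (x - t)‖ₑ := hFm.comp measurable_prodMk_left
        have h1 : ‖(φ.normed volume ⋆[lsmul ℝ ℝ, volume] F' : G → V) x‖ₑ ≤
            ∫⁻ t, ‖F' (x - t)‖ₑ ∂ν := by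
          rw [hν, lintegral_withDensity_eq_lintegral_mul _ hρm hm]
          exact φ.enorm_convolution_le F' x
        have h2 : ∫⁻ t, ‖F' (x - t)‖ₑ ∂ν ≤ (∫⁻ t, ‖F' (x - t)‖ₑ ^ p ∂ν) ^ (1 / p) := by
          have hs : AEStronglyMeasurable (fun t => F' (x - t)) ν :=
            (hF'.comp_measurable (measurable_const.sub measurable_id)).aestronglyMeasurable
          have := eLpNorm_le_eLpNorm_of_exponent_le hP1 hs
          rwa [eLpNorm_one_eq_lintegral_enorm,
            eLpNorm_eq_lintegral_rpow_enorm_toReal hP0 hPt] at this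
        calc _ ≤ ((∫⁻ t, ‖F' (x - t)‖ₑ ^ p ∂ν) ^ (1 / p)) ^ p := by
              gcongr
              exact h1.trans h2
          _ = _ := by rw [← ENNReal.rpow_mul, one_div_mul_cancel hp0.ne', ENNReal.rpow_one]
    _ = ∫⁻ t, ∫⁻ x, ‖F' (x - t)‖ₑ ^ p ∂volume ∂ν :=
        lintegral_lintegral_swap (hFm.pow_const p).aemeasurable
    _ = ∫⁻ _, ∫⁻ x, ‖F' x‖ₑ ^ p ∂volume ∂ν := by
        refine lintegral_congr fun t => ?_
        exact lintegral_sub_right_eq_self (fun x => ‖F' x‖ₑ ^ p) t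
    _ = ∫⁻ x, ‖F' x‖ₑ ^ p := by simp

/-- Mollifications of a bounded function converge when tested against an integrable function. -/
lemma tendsto_lintegral_mollification_of_bounded {φ : ℕ → ContDiffBump (0 : G)}
    {F : G → V} {R : ℝ} (hR : 0 ≤ R) (hF : LocallyIntegrable F volume) (hFR : ∀ᵐ x, ‖F x‖ ≤ R)
    {μ : Measure G} (hμ : μ ≪ volume)
    (hlim : ∀ᵐ x, Tendsto (fun j => ((φ j).normed volume ⋆[lsmul ℝ ℝ, volume] F : G → V) x)
      atTop (𝓝 (F x)))
    {B : G → ℝ} (hB : Integrable B μ) :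
    Tendsto (fun j => ∫⁻ x, ‖B x‖ₑ *
      ‖((φ j).normed volume ⋆[lsmul ℝ ℝ, volume] F : G → V) x - F x‖ₑ ∂μ) atTop (𝓝 0) := by
  have hconv : ∀ j, Continuous ((φ j).normed volume ⋆[lsmul ℝ ℝ, volume] F : G → V) := fun j =>
    (φ j).hasCompactSupport_normed.continuous_convolution_left _ (φ j).continuous_normed hF
  have h0 : ∫⁻ _, (0 : ℝ≥0∞) ∂μ = 0 := lintegral_zero
  rw [← h0]
  refine tendsto_lintegral_of_dominated_convergence' (fun x => ‖B x‖ₑ * ENNReal.ofReal (R + R))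
    (fun j => ?_) (fun j => ?_) ?_ ?_
  · exact hB.1.enorm.mul (((hconv j).aestronglyMeasurable).sub
      (hF.aestronglyMeasurable.mono_ac hμ)).enorm
  · filter_upwards [hμ hFR] with x hx
    gcongr
    rw [← ofReal_norm]
    exact ENNReal.ofReal_le_ofReal ((norm_sub_le _ _).trans
      (add_le_add ((φ j).norm_convolution_le hR hFR x) hx))
  · rw [lintegral_mul_const' _ _ ENNReal.ofReal_ne_top]
    exact ENNReal.mul_ne_top hB.2.ne ENNReal.ofReal_ne_top
  · filter_upwards [hμ hlim] with x hx
    have h1 : Tendsto (fun j => ‖((φ j).normed volume ⋆[lsmul ℝ ℝ, volume] F : G → V) x - F x‖ₑ)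
        atTop (𝓝 0) := by
      have := (hx.sub_const (F x)).enorm
      simpa using this
    have h2 := ENNReal.Tendsto.const_mul h1 (Or.inr (enorm_ne_top (x := B x)))
    simpa using h2

/-- Mollifications of an `L^P` function converge when tested against functions in the dual
space, for all `1 ≤ P ≤ ∞`. -/
lemma tendsto_lintegral_mollification [CompleteSpace V] {φ : ℕ → ContDiffBump (0 : G)}
    (hφ : Tendsto (fun j => (φ j).rOut) atTop (𝓝 0)) (hφ' : ∀ j, (φ j).rOut ≤ 2 * (φ j).rIn)
    {P P' : ℝ≥0∞} [hPP : ENNReal.HolderConjugate P' P] {F : G → V} (hF : MemLp F P volume)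
    (hFi : LocallyIntegrable F volume)
    {μ : Measure G} [IsFiniteMeasure μ] (hμ : μ ≤ volume) {B : G → ℝ} (hB : MemLp B P' μ) :
    Tendsto (fun j => ∫⁻ x, ‖B x‖ₑ *
      ‖((φ j).normed volume ⋆[lsmul ℝ ℝ, volume] F : G → V) x - F x‖ₑ ∂μ) atTop (𝓝 0) := by
  have hP1 : 1 ≤ P := ENNReal.HolderConjugate.one_le P P'
  have hP'1 : 1 ≤ P' := ENNReal.HolderConjugate.one_le P' P
  have hBi : Integrable B μ := memLp_one_iff_integrable.1 (hB.mono_exponent hP'1)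
  have hμ' : μ ≪ volume := Measure.absolutelyContinuous_of_le hμ
  -- Bounded continuous functions are not dense for `P = ∞`, but there `F` itself is bounded and
  -- dominated convergence applies.
  rcases eq_or_ne P ⊤ with rfl | hPt
  · exact tendsto_lintegral_mollification_of_bounded ENNReal.toReal_nonneg hFi
      hF.ae_norm_le_toReal hμ'
      (ContDiffBump.ae_convolution_tendsto_right_of_locallyIntegrable hφ
        (Eventually.of_forall hφ') hFi) hBi
  · rw [ENNReal.tendsto_nhds_zero]
    intro ε hε
    rcases eq_or_ne ε ⊤ with rfl | hεt
    · simp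
    set b := eLpNorm B P' μ with hb
    have hbt : b ≠ ⊤ := hB.2.ne
    have hη0 : ε / (2 * (2 * (b + 1))) ≠ 0 := by
      refine (ENNReal.div_pos hε.ne' ?_).ne'
      finiteness
    -- The bounded continuous part `g` converges by the previous lemma. The remainder `F - g` and
    -- its mollification are each at most `η` in `L^P`, and `η` is chosen so that Hölder gives `b (η
    -- + η) ≤ ε / 2`.
    obtain ⟨g, hg, hgm⟩ := hF.exists_boundedContinuous_eLpNorm_sub_le hPt hη0
    set η := ε / (2 * (2 * (b + 1))) with hη
    have hgi : LocallyIntegrable g volume := g.continuous.locallyIntegrable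
    have hlim := tendsto_lintegral_mollification_of_bounded (φ := φ) (norm_nonneg g) hgi
      (Eventually.of_forall g.norm_coe_le_norm) hμ'
      (Eventually.of_forall (ContDiffBump.convolution_tendsto_right_of_continuous hφ g.continuous))
      hBi
    have hε2 : (0 : ℝ≥0∞) < ε / 2 := ENNReal.half_pos hε.ne'
    filter_upwards [ENNReal.tendsto_nhds_zero.1 hlim _ hε2] with j hj
    set h : G → V := F - g with hh
    have hhm : AEStronglyMeasurable h volume := hF.1.sub hgm.1
    have hhi : LocallyIntegrable h volume := hFi.sub hgi
    have hsplit : ((φ j).normed volume ⋆[lsmul ℝ ℝ, volume] F : G → V) =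
        ((φ j).normed volume ⋆[lsmul ℝ ℝ, volume] g : G → V) +
        ((φ j).normed volume ⋆[lsmul ℝ ℝ, volume] h : G → V) := by
      have hFe : F = (g : G → V) + h := by simp [hh]
      conv_lhs => rw [hFe]
      exact ConvolutionExists.distrib_add
        ((φ j).hasCompactSupport_normed.convolutionExists_left _ (φ j).continuous_normed hgi)
        ((φ j).hasCompactSupport_normed.convolutionExists_left _ (φ j).continuous_normed hhi)
    set H : G → V := ((φ j).normed volume ⋆[lsmul ℝ ℝ, volume] h : G → V) - h with hH
    have hHm : AEStronglyMeasurable H volume :=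
      ((φ j).hasCompactSupport_normed.continuous_convolution_left _
        (φ j).continuous_normed hhi).aestronglyMeasurable.sub hhm
    have hH1 : eLpNorm H P μ ≤ η + η := by
      refine (eLpNorm_mono_measure _ hμ).trans ?_
      refine (eLpNorm_sub_le ((φ j).hasCompactSupport_normed.continuous_convolution_left _
        (φ j).continuous_normed hhi).aestronglyMeasurable hhm hP1).trans ?_
      exact add_le_add (((φ j).eLpNorm_convolution_le hP1 hPt hhm).trans hg) hg
    have hH2 : ∫⁻ x, ‖B x‖ₑ * ‖H x‖ₑ ∂μ ≤ b * (η + η) := by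
      have h1 := eLpNorm_smul_le_mul_eLpNorm (p := P') (q := P) (r := 1)
        (hHm.mono_measure hμ) hB.1
      rw [eLpNorm_one_eq_lintegral_enorm] at h1
      simp only [Pi.smul_apply', enorm_smul] at h1
      exact h1.trans (by gcongr)
    have hH3 : b * (η + η) ≤ ε / 2 := by
      have h2 : (b + 1) * (η + η) = ε / 2 := by
        rw [hη, ← two_mul, ← mul_assoc, mul_comm (b + 1) 2, div_eq_mul_inv,
          ENNReal.mul_inv (Or.inl two_ne_zero) (Or.inl ENNReal.ofNat_ne_top), div_eq_mul_inv]
        calc 2 * (b + 1) * (ε * (2⁻¹ * (2 * (b + 1))⁻¹))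
            = (2 * (b + 1)) * (2 * (b + 1))⁻¹ * (ε * 2⁻¹) := by ring
          _ = ε * 2⁻¹ := by
            rw [ENNReal.mul_inv_cancel (by simp) (by finiteness), one_mul]
      rw [← h2]
      gcongr
      exact le_self_add
    calc ∫⁻ x, ‖B x‖ₑ * ‖((φ j).normed volume ⋆[lsmul ℝ ℝ, volume] F : G → V) x - F x‖ₑ ∂μ
        ≤ ∫⁻ x, (‖B x‖ₑ * ‖((φ j).normed volume ⋆[lsmul ℝ ℝ, volume] g : G → V) x - g x‖ₑ +
            ‖B x‖ₑ * ‖H x‖ₑ) ∂μ := by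
          refine lintegral_mono fun x => ?_
          rw [← mul_add]
          gcongr
          have : ((φ j).normed volume ⋆[lsmul ℝ ℝ, volume] F : G → V) x - F x =
              (((φ j).normed volume ⋆[lsmul ℝ ℝ, volume] g : G → V) x - g x) + H x := by
            rw [hsplit]
            simp only [hH, hh, Pi.add_apply, Pi.sub_apply]
            abel
          rw [this]
          exact enorm_add_le _ _
      _ = ∫⁻ x, ‖B x‖ₑ * ‖((φ j).normed volume ⋆[lsmul ℝ ℝ, volume] g : G → V) x - g x‖ₑ ∂μ +
            ∫⁻ x, ‖B x‖ₑ * ‖H x‖ₑ ∂μ :=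
          lintegral_add_right' _ (hB.1.enorm.mul (hHm.mono_measure hμ).enorm)
      _ ≤ ε / 2 + ε / 2 := add_le_add hj (hH2.trans hH3)
      _ = ε := ENNReal.add_halves ε

end Mollification

/-! ### Smooth local approximation of Sobolev functions -/

section Approximation

open Filter Topology ContinuousLinearMap
open scoped Convolution

lemma exists_contDiff_cutoff {n : ℕ} {Ω K : Set (EuclideanSpace ℝ (Fin n))} (hΩ : IsOpen Ω)
    (hK : IsCompact K) (hKΩ : K ⊆ Ω) :
    ∃ χ : EuclideanSpace ℝ (Fin n) → ℝ, ContDiff ℝ ∞ χ ∧ HasCompactSupport χ ∧ tsupport χ ⊆ Ω ∧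
      (∀ x, χ x ∈ Icc (0 : ℝ) 1) ∧ ∀ x ∈ K, χ =ᶠ[𝓝 x] fun _ => 1 := by
  obtain ⟨L, hL, hKL, hLΩ⟩ := exists_compact_between hK hΩ hKΩ
  obtain ⟨χ, h1, h0, h01⟩ := exists_contMDiffMap_one_nhds_of_subset_interior
    (modelWithCornersSelf ℝ (EuclideanSpace ℝ (Fin n))) (n := ⊤) hK.isClosed hKL
  have hsupp : tsupport χ ⊆ L :=
    closure_minimal (fun x hx => by_contra fun hxL => hx (h0 x hxL)) hL.isClosed
  refine ⟨χ, χ.contMDiff.contDiff, hL.of_isClosed_subset (isClosed_tsupport _) hsupp,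
    hsupp.trans hLΩ, h01, fun x hx => ?_⟩
  exact h1.filter_mono (nhds_le_nhdsSet hx)

/-- Mollification commutes with the weak gradient. -/
lemma IsWeakGradient.gradient_convolution {n : ℕ} {Ω K : Set (EuclideanSpace ℝ (Fin n))}
    {w : EuclideanSpace ℝ (Fin n) → ℝ}
    {Dw : EuclideanSpace ℝ (Fin n) → EuclideanSpace ℝ (Fin n)} (h : IsWeakGradient Ω w Dw)
    (hΩ : MeasurableSet Ω) (hK : MeasurableSet K) (hKΩ : K ⊆ Ω) (hw : IntegrableOn w K)
    (hDw : IntegrableOn Dw K) (φ : ContDiffBump (0 : EuclideanSpace ℝ (Fin n)))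
    {x : EuclideanSpace ℝ (Fin n)} (hx : Metric.closedBall x φ.rOut ⊆ K) :
    gradient (φ.normed volume ⋆[lsmul ℝ ℝ, volume] K.indicator w) x =
      (φ.normed volume ⋆[lsmul ℝ ℝ, volume] K.indicator Dw :
        EuclideanSpace ℝ (Fin n) → EuclideanSpace ℝ (Fin n)) x := by
  set ρ := φ.normed (volume : Measure (EuclideanSpace ℝ (Fin n))) with hρ
  have hρd : ContDiff ℝ ∞ ρ := φ.contDiff_normed
  have hρc : HasCompactSupport ρ := φ.hasCompactSupport_normed
  have hwi : Integrable (K.indicator w) volume := (integrable_indicator_iff hK).2 hw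
  have hDwi : Integrable (K.indicator Dw) volume := (integrable_indicator_iff hK).2 hDw
  have hfd := hρc.hasFDerivAt_convolution_left (lsmul ℝ ℝ) (hρd.of_le (by simp))
    hwi.locallyIntegrable x
  -- The reflected and translated kernel is the test function in the weak gradient identity. Its
  -- support lies in the ball about `x`, hence in `K`, so the truncations by indicators do not
  -- matter.
  set ψ : EuclideanSpace ℝ (Fin n) → ℝ := fun t => ρ (x - t) with hψ
  have hψd : ContDiff ℝ ∞ ψ := hρd.comp (contDiff_const.sub contDiff_id)
  have hψt : tsupport ψ ⊆ Metric.closedBall x φ.rOut := by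
    refine closure_minimal (fun t ht => ?_) Metric.isClosed_closedBall
    have h1 : x - t ∈ Function.support ρ := ht
    rw [hρ, φ.support_normed_eq, mem_ball_zero_iff] at h1
    rw [mem_closedBall_iff_norm']
    exact h1.le
  have hψc : HasCompactSupport ψ :=
    (isCompact_closedBall x φ.rOut).of_isClosed_subset (isClosed_tsupport _) hψt
  have hψg : ∀ t y, inner ℝ (gradient ψ t) y = - fderiv ℝ ρ (x - t) y := by
    intro t y
    rw [inner_gradient_left]
    have h1 : HasFDerivAt ψ (fderiv ℝ ρ (x - t) ∘L (-ContinuousLinearMap.id ℝ _)) t := by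
      have h2 : HasFDerivAt (fun t => x - t) (-ContinuousLinearMap.id ℝ _) t := by
        simpa using (hasFDerivAt_id t).const_sub x
      exact ((hρd.differentiable (by simp) (x - t)).hasFDerivAt).comp t h2
    rw [h1.fderiv]
    simp
  have hψg0 : ∀ t, t ∉ K → gradient ψ t = 0 := by
    intro t ht
    have : t ∉ tsupport (fderiv ℝ ψ) := fun h' => ht (hx (hψt (tsupport_fderiv_subset ℝ h')))
    rw [gradient, image_eq_zero_of_notMem_tsupport this, map_zero]
  have hψ0 : ∀ t, t ∉ K → ψ t = 0 := fun t ht =>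
    image_eq_zero_of_notMem_tsupport fun h' => ht (hx (hψt h'))
  have hweak := h ψ hψd hψc (hψt.trans (hx.trans hKΩ))
  have hgradc : Continuous (gradient ψ) :=
    (InnerProductSpace.toDual ℝ _).symm.continuous.comp (hψd.continuous_fderiv (by simp))
  have hl : ∫ t in Ω, w t • gradient ψ t = ∫ t, K.indicator w t • gradient ψ t := by
    rw [← integral_indicator hΩ]
    refine integral_congr_ae (Eventually.of_forall fun t => ?_)
    by_cases htK : t ∈ K
    · simp [htK, hKΩ htK]
    · by_cases htΩ : t ∈ Ω <;> simp [htΩ, hψg0 t htK]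
  have hr : ∫ t in Ω, ψ t • Dw t = ∫ t, ρ (x - t) • K.indicator Dw t := by
    rw [← integral_indicator hΩ]
    refine integral_congr_ae (Eventually.of_forall fun t => ?_)
    by_cases htK : t ∈ K
    · simp [htK, hKΩ htK, hψ]
    · by_cases htΩ : t ∈ Ω <;> simp [htΩ, htK, hψ0 t htK]
  have hFi : Integrable (fun t => K.indicator w t • gradient ψ t) volume := by
    have hgc : HasCompactSupport (gradient ψ) := by
      refine (hψc.fderiv ℝ).mono fun t ht => ?_
      intro h0
      apply ht
      rw [gradient, h0, map_zero]
    obtain ⟨C, hC⟩ := hgc.exists_bound_of_continuous hgradc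
    exact hwi.smul_bdd C hgradc.aestronglyMeasurable (Eventually.of_forall hC)
  rw [convolution_lsmul_swap, ← hr]
  have hneg : ∫ t in Ω, ψ t • Dw t = -∫ t, K.indicator w t • gradient ψ t := by
    rw [← hl, hweak, neg_neg]
  rw [hneg]
  refine ext_inner_right ℝ fun y => ?_
  rw [inner_gradient_left, hfd.fderiv, inner_neg_left, real_inner_comm, ← integral_inner hFi,
    convolution_eq_swap, ContinuousLinearMap.integral_apply, ← integral_neg]
  · refine integral_congr_ae (Eventually.of_forall fun t => ?_)
    simp only [precompL_apply, lsmul_apply, smul_eq_mul, real_inner_smul_right]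
    rw [real_inner_comm, hψg]
    ring
  · have := (hρc.fderiv ℝ).convolutionExists_left ((lsmul ℝ ℝ).precompL (EuclideanSpace ℝ (Fin n)))
      (hρd.continuous_fderiv (by simp)) hwi.locallyIntegrable (x := x)
    have h2 := this.integrable_swap
    exact h2

lemma MemLpLoc.mono_exponent {n : ℕ} {Y : Type*} [NormedAddCommGroup Y]
    {Ω : Set (EuclideanSpace ℝ (Fin n))} {s t : ℝ≥0∞} {F : EuclideanSpace ℝ (Fin n) → Y}
    (h : MemLpLoc Ω s F) (hts : t ≤ s) : MemLpLoc Ω t F := by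
  intro K hK hKΩ
  have : IsFiniteMeasure (volume.restrict K) := ⟨by simpa using hK.measure_lt_top⟩
  exact (h K hK hKΩ).mono_exponent hts

/-- Local approximation of a locally bounded Sobolev function by smooth functions. -/
lemma exists_smooth_approx {n : ℕ} {Ω : Set (EuclideanSpace ℝ (Fin n))} (hΩ : IsOpen Ω)
    {P P' : ℝ≥0∞} [hPP : ENNReal.HolderConjugate P' P] {w : EuclideanSpace ℝ (Fin n) → ℝ}
    {Dw : EuclideanSpace ℝ (Fin n) → EuclideanSpace ℝ (Fin n)} (hw : MemLpLoc Ω ⊤ w)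
    (hDw : MemLpLoc Ω P Dw) (hg : IsWeakGradient Ω w Dw) {K : Set (EuclideanSpace ℝ (Fin n))}
    (hK : IsCompact K) (hKΩ : K ⊆ Ω) :
    ∃ (W : ℕ → EuclideanSpace ℝ (Fin n) → ℝ) (R : ℝ), (∀ j, ContDiff ℝ ∞ (W j)) ∧
      (∀ j x, |W j x| ≤ R) ∧
      (∀ᵐ x ∂(volume.restrict K), Tendsto (fun j => W j x) atTop (𝓝 (w x))) ∧
      ∀ B : EuclideanSpace ℝ (Fin n) → ℝ, MemLp B P' (volume.restrict K) →
        Tendsto (fun j => ∫⁻ x in K, ‖B x‖ₑ * ‖gradient (W j) x - Dw x‖ₑ) atTop (𝓝 0) := by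
  -- The compact thickening leaves room for mollification: for `x ∈ K` every kernel of radius at
  -- most `δ` sees only points of `L ⊆ Ω`.
  obtain ⟨δ, hδ, hδΩ⟩ := hK.exists_cthickening_subset_open hΩ hKΩ
  set L := Metric.cthickening δ K with hLdef
  have hL : IsCompact L := hK.cthickening
  have hKL : K ⊆ L := Metric.self_subset_cthickening K
  have hLm : MeasurableSet L := hL.measurableSet
  have : IsFiniteMeasure (volume.restrict L) := ⟨by simpa using hL.measure_lt_top⟩
  have : IsFiniteMeasure (volume.restrict K) := ⟨by simpa using hK.measure_lt_top⟩
  have hP1 : 1 ≤ P := ENNReal.HolderConjugate.one_le P P'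
  have hwL := hw L hL hδΩ
  have hDL := hDw L hL hδΩ
  have hwi : IntegrableOn w L := memLp_one_iff_integrable.1 (hwL.mono_exponent le_top)
  have hDi : IntegrableOn Dw L := memLp_one_iff_integrable.1 (hDL.mono_exponent hP1)
  have hwi' : Integrable (L.indicator w) volume := (integrable_indicator_iff hLm).2 hwi
  have hDi' : Integrable (L.indicator Dw) volume := (integrable_indicator_iff hLm).2 hDi
  have hDP : MemLp (L.indicator Dw) P volume := (memLp_indicator_iff_restrict hLm).2 hDL
  set R := (eLpNorm w ⊤ (volume.restrict L)).toReal with hR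
  have hR0 : 0 ≤ R := ENNReal.toReal_nonneg
  have hwR : ∀ᵐ x, ‖L.indicator w x‖ ≤ R := by
    have h1 := (ae_restrict_iff' hLm).1 (MemLp.ae_norm_le_toReal hwL)
    filter_upwards [h1] with x hx
    by_cases hxL : x ∈ L
    · rw [indicator_of_mem hxL]
      exact hx hxL
    · simpa [hxL] using hR0
  -- The fixed ratio of outer to inner radius is what gives a.e. convergence of the mollifications
  -- of locally integrable functions.
  let φ : ℕ → ContDiffBump (0 : EuclideanSpace ℝ (Fin n)) := fun j =>
    ⟨δ / ((j : ℝ) + 1) / 2, δ / ((j : ℝ) + 1), by positivity, half_lt_self (by positivity)⟩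
  have hφ : Tendsto (fun j => (φ j).rOut) atTop (𝓝 0) := by
    have := (tendsto_one_div_add_atTop_nhds_zero_nat (𝕜 := ℝ)).const_mul δ
    rw [mul_zero] at this
    refine this.congr fun j => ?_
    simp only [φ]
    ring
  have hφ' : ∀ j, (φ j).rOut ≤ 2 * (φ j).rIn := fun j => by
    simp only [φ]
    linarith
  have hφδ : ∀ j, (φ j).rOut ≤ δ := fun j => by
    simp only [φ]
    exact div_le_self hδ.le (by linarith [(Nat.cast_nonneg j : (0 : ℝ) ≤ j)])
  refine ⟨fun j => (φ j).normed volume ⋆[lsmul ℝ ℝ, volume] L.indicator w, R, fun j => ?_,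
    fun j x => ?_, ?_, fun B hB => ?_⟩
  · exact (φ j).hasCompactSupport_normed.contDiff_convolution_left (n := ⊤) _
      (φ j).contDiff_normed hwi'.locallyIntegrable
  · exact (φ j).norm_convolution_le hR0 hwR x
  · have h1 := ContDiffBump.ae_convolution_tendsto_right_of_locallyIntegrable hφ
      (Eventually.of_forall hφ') hwi'.locallyIntegrable
    rw [ae_restrict_iff' hK.measurableSet]
    filter_upwards [h1] with x hx hxK
    rwa [indicator_of_mem (hKL hxK)] at hx
  · have h1 := tendsto_lintegral_mollification hφ hφ' (P' := P') hDP hDi'.locallyIntegrable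
      (Measure.restrict_le_self (s := K)) hB
    refine h1.congr fun j => ?_
    refine setLIntegral_congr_fun hK.measurableSet fun x hxK => ?_
    have hball : Metric.closedBall x (φ j).rOut ⊆ L :=
      (Metric.closedBall_subset_closedBall (hφδ j)).trans
        (Metric.closedBall_subset_cthickening hxK δ)
    simp only []
    rw [hg.gradient_convolution hΩ.measurableSet hLm hδΩ hwi hDi (φ j) hball,
      indicator_of_mem (hKL hxK)]

end Approximation

/-! ### Approximation of `Θ ∘ w` by admissible test functions -/

section TestFunctions

open Filter Topology

/-- Compositions `Θ ∘ w` of a Sobolev function `w`, which is at most `k₀` off a compact set, with a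
`C¹` function `Θ` vanishing below `k₀` are limits of admissible test functions. -/
lemma exists_test_approx {n : ℕ} {Ω : Set (EuclideanSpace ℝ (Fin n))} (hΩ : IsOpen Ω)
    {P P' : ℝ≥0∞} [hPP : ENNReal.HolderConjugate P' P] {w : EuclideanSpace ℝ (Fin n) → ℝ}
    {Dw : EuclideanSpace ℝ (Fin n) → EuclideanSpace ℝ (Fin n)} (hw : MemLpLoc Ω ⊤ w)
    (hDw : MemLpLoc Ω P Dw) (hg : IsWeakGradient Ω w Dw) {K : Set (EuclideanSpace ℝ (Fin n))}
    (hK : IsCompact K) (hKΩ : K ⊆ Ω) {k₀ : ℝ}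
    (hout : ∀ᵐ x ∂(volume.restrict Ω), x ∉ K → w x ≤ k₀) {Θ Θ' : ℝ → ℝ}
    (hΘ : ∀ t, HasDerivAt Θ (Θ' t) t) (hΘc : Continuous Θ') (hΘ0 : ∀ t, 0 ≤ Θ t)
    (hΘk : ∀ t ≤ k₀, Θ t = 0) (hΘk' : ∀ t ≤ k₀, Θ' t = 0) :
    ∃ (K₁ : Set (EuclideanSpace ℝ (Fin n))) (Y : ℕ → EuclideanSpace ℝ (Fin n) → ℝ) (R : ℝ),
      IsCompact K₁ ∧ K₁ ⊆ Ω ∧ K ⊆ K₁ ∧ (∀ j, ContDiff ℝ 1 (Y j)) ∧ (∀ j, tsupport (Y j) ⊆ K₁) ∧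
      (∀ j x, 0 ≤ Y j x) ∧ (∀ j x, Y j x ≤ R) ∧
      (∀ᵐ x ∂(volume.restrict Ω), Tendsto (fun j => Y j x) atTop (𝓝 (Θ (w x)))) ∧
      ∀ B : EuclideanSpace ℝ (Fin n) → ℝ, MemLpLoc Ω P' B →
        Tendsto (fun j => ∫⁻ x in Ω, ‖B x‖ₑ * ‖gradient (Y j) x - Θ' (w x) • Dw x‖ₑ)
          atTop (𝓝 0) := by
  obtain ⟨χ, hχd, hχc, hχΩ, hχ01, hχ1⟩ := exists_contDiff_cutoff hΩ hK hKΩ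
  set K₁ := tsupport χ with hK₁
  have hK₁c : IsCompact K₁ := hχc
  have hKK₁ : K ⊆ K₁ := fun x hx => subset_tsupport χ (by
    rw [Function.mem_support, (hχ1 x hx).self_of_nhds]
    exact one_ne_zero)
  have hK₁m : MeasurableSet K₁ := hK₁c.measurableSet
  obtain ⟨W, R, hWd, hWR, hWlim, hWg⟩ := exists_smooth_approx hΩ (P' := P') hw hDw hg hK₁c hχΩ
  have hΘcont : Continuous Θ := continuous_iff_continuousAt.2 fun t => (hΘ t).continuousAt
  obtain ⟨L, hL⟩ := (isCompact_Icc (a := -R) (b := R)).exists_bound_of_continuousOn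
    hΘcont.continuousOn
  obtain ⟨L', hL'⟩ := (isCompact_Icc (a := -R) (b := R)).exists_bound_of_continuousOn
    hΘc.continuousOn
  have hR0 : 0 ≤ R := (abs_nonneg _).trans (hWR 0 0)
  have hL0 : 0 ≤ L := (norm_nonneg _).trans (hL 0 ⟨by linarith, hR0⟩)
  have hL'0 : 0 ≤ L' := (norm_nonneg _).trans (hL' 0 ⟨by linarith, hR0⟩)
  have hΘd : ContDiff ℝ 1 Θ := by
    rw [contDiff_one_iff_deriv]
    refine ⟨fun t => (hΘ t).differentiableAt, ?_⟩
    rwa [show deriv Θ = Θ' from funext fun t => (hΘ t).deriv]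
  -- The cutoff is needed because `W j` may exceed `k₀` off `K` even where `w` does not. It costs
  -- nothing in the limit: `χ = 1` near `K`, and `Θ (w x) = 0` off `K`.
  set Y : ℕ → EuclideanSpace ℝ (Fin n) → ℝ := fun j x => χ x * Θ (W j x) with hY
  have hχg : ∀ x, HasGradientAt χ (gradient χ x) x := fun x =>
    ((hχd.differentiable (by simp)) x).hasGradientAt
  have hYg : ∀ j x, gradient (Y j) x =
      (χ x * Θ' (W j x)) • gradient (W j) x + Θ (W j x) • gradient χ x := by
    intro j x
    have h1 : HasFDerivAt χ (InnerProductSpace.toDual ℝ _ (gradient χ x)) x := hχg x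
    have h2 : HasFDerivAt (W j) (InnerProductSpace.toDual ℝ _ (gradient (W j) x)) x :=
      (((hWd j).differentiable (by simp)) x).hasGradientAt
    have h3 := h1.mul ((hΘ (W j x)).comp_hasFDerivAt x h2)
    refine HasGradientAt.gradient ?_
    rw [hasGradientAt_iff_hasFDerivAt]
    have h4 : InnerProductSpace.toDual ℝ _
        ((χ x * Θ' (W j x)) • gradient (W j) x + Θ (W j x) • gradient χ x) =
        χ x • (Θ' (W j x) • InnerProductSpace.toDual ℝ _ (gradient (W j) x)) +
          Θ (W j x) • InnerProductSpace.toDual ℝ _ (gradient χ x) := by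
      rw [map_add, map_smulₛₗ, map_smulₛₗ, smul_smul]
      rfl
    rw [h4]
    exact h3
  have hYt : ∀ j, tsupport (Y j) ⊆ K₁ := fun j => tsupport_mul_subset_left
  have hYlim : ∀ᵐ x ∂(volume.restrict Ω), Tendsto (fun j => Y j x) atTop (𝓝 (Θ (w x))) := by
    have h1 := ae_restrict_of_ae (s := Ω) ((ae_restrict_iff' hK₁m).1 hWlim)
    filter_upwards [h1, hout] with x hx hxo
    by_cases hxK : x ∈ K
    · have : χ x = 1 := (hχ1 x hxK).self_of_nhds
      simp only [hY, this, one_mul]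
      exact (hΘcont.tendsto _).comp (hx (hKK₁ hxK))
    · have hz : Θ (w x) = 0 := hΘk _ (hxo hxK)
      by_cases hx1 : x ∈ K₁
      · have := ((hΘcont.tendsto _).comp (hx hx1)).const_mul (χ x)
        rw [hz, mul_zero] at this
        rw [hz]
        exact this
      · have : ∀ j, Y j x = 0 := fun j => by
          simp [hY, image_eq_zero_of_notMem_tsupport hx1]
        simp only [this, hz]
        exact tendsto_const_nhds
  refine ⟨K₁, Y, L, hK₁c, hχΩ, hKK₁, fun j => (hχd.of_le (by simp)).mul
    (hΘd.comp ((hWd j).of_le (by simp))), hYt, fun j x => mul_nonneg (hχ01 x).1 (hΘ0 _),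
    fun j x => ?_, hYlim, fun B hB => ?_⟩
  · have h1 : Θ (W j x) ≤ L := (le_abs_self _).trans (hL _ (abs_le.1 (hWR j x)))
    calc χ x * Θ (W j x) ≤ 1 * L := mul_le_mul (hχ01 x).2 h1 (hΘ0 _) zero_le_one
      _ = L := one_mul L
  have hfin : IsFiniteMeasure (volume.restrict K₁) := ⟨by simpa using hK₁c.measure_lt_top⟩
  have hB₁ := hB K₁ hK₁c hχΩ
  have hD₁ := hDw K₁ hK₁c hχΩ
  have hw₁ := hw K₁ hK₁c hχΩ
  have hP'1 : 1 ≤ P' := ENNReal.HolderConjugate.one_le P' P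
  have hBi : Integrable B (volume.restrict K₁) :=
    memLp_one_iff_integrable.1 (hB₁.mono_exponent hP'1)
  have hBD : ∫⁻ x in K₁, ‖B x‖ₑ * ‖Dw x‖ₑ ≠ ⊤ := by
    have h1 := (hD₁.smul (r := 1) hB₁).2
    rw [eLpNorm_one_eq_lintegral_enorm] at h1
    simp only [Pi.smul_apply', enorm_smul] at h1
    exact h1.ne
  have hgc : Continuous (gradient χ) :=
    (InnerProductSpace.toDual ℝ _).symm.continuous.comp (hχd.continuous_fderiv (by simp))
  obtain ⟨Cχ, hCχ⟩ := hK₁c.exists_bound_of_continuousOn hgc.continuousOn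
  -- `Z j` is what remains of the gradient error after removing `(χ Θ'(W j)) (∇W j - Dw)`. It
  -- contains no gradient of `W j`, so it tends to `0` by dominated convergence.
  set Z : ℕ → EuclideanSpace ℝ (Fin n) → EuclideanSpace ℝ (Fin n) := fun j x =>
    (χ x * Θ' (W j x) - Θ' (w x)) • Dw x + Θ (W j x) • gradient χ x with hZ
  have hZlim : Tendsto (fun j => ∫⁻ x in K₁, ‖B x‖ₑ * ‖Z j x‖ₑ) atTop (𝓝 0) := by
    have h0 : ∫⁻ _ in K₁, (0 : ℝ≥0∞) = 0 := lintegral_zero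
    rw [← h0]
    refine tendsto_lintegral_of_dominated_convergence'
      (fun x => ENNReal.ofReal (L' + L') * (‖B x‖ₑ * ‖Dw x‖ₑ) + ‖B x‖ₑ * ENNReal.ofReal (L * Cχ))
      (fun j => ?_) (fun j => ?_) ?_ ?_
    · have h1 : AEStronglyMeasurable (fun x => Θ' (w x)) (volume.restrict K₁) :=
        hΘc.comp_aestronglyMeasurable hw₁.1
      have h2 : AEStronglyMeasurable (Z j) (volume.restrict K₁) :=
        (((hχd.continuous.mul (hΘc.comp (hWd j).continuous)).aestronglyMeasurable.sub h1).smul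
          hD₁.1).add ((hΘcont.comp (hWd j).continuous).smul hgc).aestronglyMeasurable
      exact hB₁.1.enorm.mul h2.enorm
    · filter_upwards [hWlim, ae_restrict_mem hK₁m] with x hx hxK₁
      have hwR : |w x| ≤ R := le_of_tendsto' hx.abs (fun j => hWR j x)
      have e1 : ‖χ x * Θ' (W j x) - Θ' (w x)‖ ≤ L' + L' := by
        refine (norm_sub_le _ _).trans (add_le_add ?_ (hL' _ (abs_le.1 hwR)))
        rw [norm_mul]
        calc ‖χ x‖ * ‖Θ' (W j x)‖ ≤ 1 * L' := by
              refine mul_le_mul ?_ (hL' _ (abs_le.1 (hWR j x))) (norm_nonneg _) zero_le_one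
              rw [Real.norm_of_nonneg (hχ01 x).1]
              exact (hχ01 x).2
          _ = L' := one_mul _
      have e2 : ‖Θ (W j x) • gradient χ x‖ ≤ L * Cχ := by
        rw [norm_smul]
        exact mul_le_mul (hL _ (abs_le.1 (hWR j x))) (hCχ x hxK₁) (norm_nonneg _) hL0
      calc ‖B x‖ₑ * ‖Z j x‖ₑ ≤ ‖B x‖ₑ * (ENNReal.ofReal (L' + L') * ‖Dw x‖ₑ +
            ENNReal.ofReal (L * Cχ)) := by
            gcongr
            refine (enorm_add_le _ _).trans (add_le_add ?_ ?_)
            · rw [enorm_smul]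
              gcongr
              rw [← ofReal_norm]
              exact ENNReal.ofReal_le_ofReal e1
            · rw [← ofReal_norm]
              exact ENNReal.ofReal_le_ofReal e2
        _ = _ := by ring
    · rw [lintegral_add_right' _ (hB₁.1.enorm.mul_const _),
        lintegral_const_mul' _ _ ENNReal.ofReal_ne_top,
        lintegral_mul_const' _ _ ENNReal.ofReal_ne_top]
      exact ENNReal.add_ne_top.2 ⟨ENNReal.mul_ne_top ENNReal.ofReal_ne_top hBD,
        ENNReal.mul_ne_top hBi.2.ne ENNReal.ofReal_ne_top⟩
    · filter_upwards [hWlim, ae_restrict_of_ae_restrict_of_subset hχΩ hout] with x hx hxo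
      have hlim : Tendsto (fun j => Z j x) atTop
          (𝓝 ((χ x * Θ' (w x) - Θ' (w x)) • Dw x + Θ (w x) • gradient χ x)) :=
        ((((hΘc.tendsto _).comp hx).const_mul (χ x)).sub_const _ |>.smul_const _).add
          (((hΘcont.tendsto _).comp hx).smul_const _)
      have hz : (χ x * Θ' (w x) - Θ' (w x)) • Dw x + Θ (w x) • gradient χ x = 0 := by
        by_cases hxK : x ∈ K
        · rw [(hχ1 x hxK).self_of_nhds, (hχ1 x hxK).gradient_eq, gradient_fun_const]
          simp
        · rw [hΘk _ (hxo hxK), hΘk' _ (hxo hxK)]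
          simp
      rw [hz] at hlim
      have h1 := hlim.enorm
      rw [enorm_zero] at h1
      simpa using ENNReal.Tendsto.const_mul h1 (Or.inr (enorm_ne_top (x := B x)))
  have hsum := (ENNReal.Tendsto.const_mul (hWg B hB₁)
    (Or.inr (ENNReal.ofReal_ne_top (r := L')))).add hZlim
  rw [mul_zero, add_zero] at hsum
  refine tendsto_of_tendsto_of_tendsto_of_le_of_le tendsto_const_nhds hsum
    (fun _ => zero_le) fun j => ?_
  have hΩK : ∫⁻ x in Ω, ‖B x‖ₑ * ‖gradient (Y j) x - Θ' (w x) • Dw x‖ₑ =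
      ∫⁻ x in K₁, ‖B x‖ₑ * ‖gradient (Y j) x - Θ' (w x) • Dw x‖ₑ := by
    rw [← inter_eq_left.2 hχΩ, ← setLIntegral_indicator hK₁m]
    refine lintegral_congr_ae ?_
    filter_upwards [hout] with x hxo
    by_cases hx : x ∈ K₁
    · simp [hx]
    · have h1 : gradient (Y j) x = 0 := by
        have : x ∉ tsupport (fderiv ℝ (Y j)) := fun h' =>
          hx (hYt j (tsupport_fderiv_subset ℝ h'))
        rw [gradient, image_eq_zero_of_notMem_tsupport this, map_zero]
      have h2 : Θ' (w x) = 0 := hΘk' _ (hxo fun hxK => hx (hKK₁ hxK))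
      simp [hx, h1, h2]
  rw [hΩK]
  calc ∫⁻ x in K₁, ‖B x‖ₑ * ‖gradient (Y j) x - Θ' (w x) • Dw x‖ₑ
      ≤ ∫⁻ x in K₁, (ENNReal.ofReal L' * (‖B x‖ₑ * ‖gradient (W j) x - Dw x‖ₑ) +
          ‖B x‖ₑ * ‖Z j x‖ₑ) := by
        refine lintegral_mono fun x => ?_
        have e : gradient (Y j) x - Θ' (w x) • Dw x =
            (χ x * Θ' (W j x)) • (gradient (W j) x - Dw x) + Z j x := by
          rw [hYg, hZ]
          module
        have e1 : ‖χ x * Θ' (W j x)‖ ≤ L' := by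
          rw [norm_mul]
          calc ‖χ x‖ * ‖Θ' (W j x)‖ ≤ 1 * L' := by
                refine mul_le_mul ?_ (hL' _ (abs_le.1 (hWR j x))) (norm_nonneg _) zero_le_one
                rw [Real.norm_of_nonneg (hχ01 x).1]
                exact (hχ01 x).2
            _ = L' := one_mul _
        rw [e]
        calc _ ≤ ‖B x‖ₑ * (ENNReal.ofReal L' * ‖gradient (W j) x - Dw x‖ₑ + ‖Z j x‖ₑ) := by
              gcongr
              refine (enorm_add_le _ _).trans (add_le_add_left ?_ _)
              rw [enorm_smul]
              gcongr
              rw [← ofReal_norm]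
              exact ENNReal.ofReal_le_ofReal e1
          _ = _ := by ring
    _ = _ := by
        have hgW : Continuous (gradient (W j)) :=
          (InnerProductSpace.toDual ℝ _).symm.continuous.comp
            ((hWd j).continuous_fderiv (by simp))
        have hm : AEMeasurable (fun x => ‖B x‖ₑ * ‖gradient (W j) x - Dw x‖ₑ)
            (volume.restrict K₁) :=
          hB₁.1.enorm.mul (hgW.aestronglyMeasurable.sub hD₁.1).enorm
        rw [lintegral_add_left' (hm.const_mul _), lintegral_const_mul' _ _ ENNReal.ofReal_ne_top]

end TestFunctions

/-! ### Energy and Sobolev inequalities for `Θ ∘ w` -/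

section Consequences

open Filter Topology

lemma MeasureTheory.MemLp.integrable_inner {X V : Type*} [MeasurableSpace X] [NormedAddCommGroup V]
    [InnerProductSpace ℝ V] {μ : Measure X} {P P' : ℝ≥0∞} [ENNReal.HolderConjugate P' P]
    {B D : X → V} (hB : MemLp B P' μ) (hD : MemLp D P μ) :
    Integrable (fun x => inner ℝ (B x) (D x)) μ := by
  have h1 : MemLp (fun x => ‖B x‖ * ‖D x‖) 1 μ := hD.norm.mul (r := 1) hB.norm
  refine (memLp_one_iff_integrable.1 h1).mono (hB.1.inner hD.1)
    (Eventually.of_forall fun x => ?_)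
  rw [Real.norm_of_nonneg (mul_nonneg (norm_nonneg (B x)) (norm_nonneg (D x)))]
  exact norm_inner_le_norm (B x) (D x)

/-- The weak inequality `Qu ≤ Qv` may be tested with `Θ ∘ w`. -/
lemma QLe.integral_comp_le {n : ℕ} {Ω : Set (EuclideanSpace ℝ (Fin n))} (hΩ : IsOpen Ω)
    {a : EuclideanSpace ℝ (Fin n) → EuclideanSpace ℝ (Fin n) → EuclideanSpace ℝ (Fin n)}
    {H : EuclideanSpace ℝ (Fin n) → ℝ → EuclideanSpace ℝ (Fin n) → ℝ}
    {u v : EuclideanSpace ℝ (Fin n) → ℝ}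
    {Du Dv : EuclideanSpace ℝ (Fin n) → EuclideanSpace ℝ (Fin n)} (hQ : QLe Ω a H u Du v Dv)
    {P P' : ℝ≥0∞} [hPP : ENNReal.HolderConjugate P' P]
    (hB : MemLpLoc Ω P' fun x => a x (Du x) - a x (Dv x))
    (hh : MemLpLoc Ω 1 fun x => H x (v x) (Dv x) - H x (u x) (Du x))
    {w : EuclideanSpace ℝ (Fin n) → ℝ}
    {Dw : EuclideanSpace ℝ (Fin n) → EuclideanSpace ℝ (Fin n)} (hw : MemLpLoc Ω ⊤ w)
    (hDw : MemLpLoc Ω P Dw) (hg : IsWeakGradient Ω w Dw) {K : Set (EuclideanSpace ℝ (Fin n))}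
    (hK : IsCompact K) (hKΩ : K ⊆ Ω) {k₀ : ℝ}
    (hout : ∀ᵐ x ∂(volume.restrict Ω), x ∉ K → w x ≤ k₀) {Θ Θ' : ℝ → ℝ}
    (hΘ : ∀ t, HasDerivAt Θ (Θ' t) t) (hΘc : Continuous Θ') (hΘ0 : ∀ t, 0 ≤ Θ t)
    (hΘk : ∀ t ≤ k₀, Θ t = 0) (hΘk' : ∀ t ≤ k₀, Θ' t = 0) :
    ∫ x in K, Θ' (w x) * inner ℝ (a x (Du x) - a x (Dv x)) (Dw x) ≤
      ∫ x in K, (H x (v x) (Dv x) - H x (u x) (Du x)) * Θ (w x) := by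
  obtain ⟨K₁, Y, R, hK₁, hK₁Ω, hKK₁, hYd, hYt, hY0, hYR, hYlim, hYg⟩ := exists_test_approx hΩ
    (P' := P') hw hDw hg hK hKΩ hout hΘ hΘc hΘ0 hΘk hΘk'
  set B := fun x => a x (Du x) - a x (Dv x) with hBdef
  set h := fun x => H x (v x) (Dv x) - H x (u x) (Du x) with hhdef
  have hK₁m := hK₁.measurableSet
  have hP'1 : 1 ≤ P' := ENNReal.HolderConjugate.one_le P' P
  have hout' := (ae_restrict_iff' hΩ.measurableSet).1 hout
  have hzero : ∀ L : Set (EuclideanSpace ℝ (Fin n)), K ⊆ L →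
      ∀ᵐ x, x ∈ Ω \ L → Θ (w x) = 0 ∧ Θ' (w x) = 0 := by
    intro L hKL
    filter_upwards [hout'] with x hx hxL
    have := hx hxL.1 fun hxK => hxL.2 (hKL hxK)
    exact ⟨hΘk _ this, hΘk' _ this⟩
  have hYg0 : ∀ j x, x ∉ K₁ → gradient (Y j) x = 0 := by
    intro j x hx
    have : x ∉ tsupport (fderiv ℝ (Y j)) := fun h' => hx (hYt j (tsupport_fderiv_subset ℝ h'))
    rw [gradient, image_eq_zero_of_notMem_tsupport this, map_zero]
  have hY00 : ∀ j x, x ∉ K₁ → Y j x = 0 := fun j x hx =>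
    image_eq_zero_of_notMem_tsupport fun h' => hx (hYt j h')
  have hYgc : ∀ j, Continuous (gradient (Y j)) := fun j =>
    (InnerProductSpace.toDual ℝ _).symm.continuous.comp ((hYd j).continuous_fderiv one_ne_zero)
  have hB₁ := hB K₁ hK₁ hK₁Ω
  have hD₁ := hDw K₁ hK₁ hK₁Ω
  have hw₁ := hw K₁ hK₁ hK₁Ω
  have hh₁ : IntegrableOn h K₁ := memLp_one_iff_integrable.1 (hh K₁ hK₁ hK₁Ω)
  have hB₁i : IntegrableOn B K₁ :=
    memLp_one_iff_integrable.1 (hB.mono_exponent hP'1 K₁ hK₁ hK₁Ω)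
  -- integrability of the limit of the left-hand sides
  have hΘw : ∃ C, ∀ᵐ x ∂(volume.restrict K₁), ‖Θ' (w x)‖ ≤ C := by
    set r := (eLpNorm w ⊤ (volume.restrict K₁)).toReal
    obtain ⟨C, hC⟩ := (isCompact_Icc (a := -r) (b := r)).exists_bound_of_continuousOn
      hΘc.continuousOn
    refine ⟨C, ?_⟩
    filter_upwards [MemLp.ae_norm_le_toReal hw₁] with x hx
    exact hC _ (abs_le.1 hx)
  obtain ⟨C, hC⟩ := hΘw
  have hBDi : IntegrableOn (fun x => inner ℝ (B x) (Dw x)) K₁ := MemLp.integrable_inner hB₁ hD₁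
  have hlimK : IntegrableOn (fun x => inner ℝ (B x) (Θ' (w x) • Dw x)) K₁ := by
    simp only [real_inner_smul_right]
    exact hBDi.bdd_mul (hΘc.comp_aestronglyMeasurable hw₁.1) hC
  have hlimΩ : IntegrableOn (fun x => inner ℝ (B x) (Θ' (w x) • Dw x)) Ω := by
    refine hlimK.of_ae_sdiff_eq_zero hΩ.nullMeasurableSet ?_
    filter_upwards [hzero K₁ hKK₁] with x hx hxL
    rw [(hx hxL).2]
    simp
  have hYi : ∀ j, IntegrableOn (fun x => inner ℝ (B x) (gradient (Y j) x)) Ω := by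
    intro j
    have hc : HasCompactSupport (gradient (Y j)) :=
      HasCompactSupport.intro hK₁ fun x hx => hYg0 j x hx
    obtain ⟨C', hC'⟩ := hc.exists_bound_of_continuous (hYgc j)
    have h1 : IntegrableOn (fun x => inner ℝ (B x) (gradient (Y j) x)) K₁ := by
      refine Integrable.mono' (hB₁i.norm.mul_const C')
        (hB₁i.1.inner (hYgc j).aestronglyMeasurable) (Eventually.of_forall fun x => ?_)
      exact (norm_inner_le_norm _ _).trans (by gcongr; exact hC' x)
    refine h1.of_ae_sdiff_eq_zero hΩ.nullMeasurableSet (Eventually.of_forall fun x hx => ?_)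
    rw [hYg0 j x hx.2, inner_zero_right]
  have hleft : Tendsto (fun j => ∫ x in Ω, inner ℝ (B x) (gradient (Y j) x)) atTop
      (𝓝 (∫ x in Ω, inner ℝ (B x) (Θ' (w x) • Dw x))) := by
    refine tendsto_integral_of_L1 _ hlimΩ.1 (Eventually.of_forall hYi) ?_
    have hBn : MemLpLoc Ω P' fun x => ‖B x‖ := fun L hL hLΩ => (hB L hL hLΩ).norm
    refine tendsto_of_tendsto_of_tendsto_of_le_of_le tendsto_const_nhds (hYg _ hBn)
      (fun _ => zero_le) fun j => lintegral_mono fun x => ?_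
    rw [← inner_sub_right, enorm_norm, ← ofReal_norm, ← ofReal_norm, ← ofReal_norm,
      ← ENNReal.ofReal_mul (norm_nonneg _)]
    exact ENNReal.ofReal_le_ofReal (norm_inner_le_norm _ _)
  -- Here `h` is only locally integrable; the uniform bound on `Y j` and the common compact support
  -- provide the dominating function.
  have hright : Tendsto (fun j => ∫ x in Ω, h x * Y j x) atTop (𝓝 (∫ x in Ω, h x * Θ (w x))) := by
    have e1 : ∀ j, ∫ x in Ω, h x * Y j x = ∫ x in K₁, h x * Y j x := fun j =>
      setIntegral_eq_of_subset_of_forall_sdiff_eq_zero hΩ.measurableSet hK₁Ω fun x hx => by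
        rw [hY00 j x hx.2, mul_zero]
    have e2 : ∫ x in Ω, h x * Θ (w x) = ∫ x in K₁, h x * Θ (w x) := by
      refine setIntegral_eq_of_subset_of_ae_sdiff_eq_zero hΩ.nullMeasurableSet hK₁Ω ?_
      filter_upwards [hzero K₁ hKK₁] with x hx hxL
      rw [(hx hxL).1, mul_zero]
    simp only [e1, e2]
    refine tendsto_integral_of_dominated_convergence (fun x => ‖h x‖ * R) (fun j => ?_)
      (hh₁.norm.mul_const R) (fun j => Eventually.of_forall fun x => ?_) ?_
    · exact hh₁.1.mul (hYd j).continuous.aestronglyMeasurable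
    · rw [norm_mul, Real.norm_of_nonneg (hY0 j x)]
      gcongr
      exact hYR j x
    · filter_upwards [ae_restrict_of_ae_restrict_of_subset hK₁Ω hYlim] with x hx
      exact hx.const_mul _
  have hle := le_of_tendsto_of_tendsto' hleft hright fun j => hQ (Y j) (hYd j)
    (hK₁.of_isClosed_subset (isClosed_tsupport _) (hYt j)) ((hYt j).trans hK₁Ω) (hY0 j)
  have e1 : ∫ x in Ω, inner ℝ (B x) (Θ' (w x) • Dw x) =
      ∫ x in K, Θ' (w x) * inner ℝ (B x) (Dw x) := by
    simp only [real_inner_smul_right]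
    refine setIntegral_eq_of_subset_of_ae_sdiff_eq_zero hΩ.nullMeasurableSet hKΩ ?_
    filter_upwards [hzero K subset_rfl] with x hx hxL
    rw [(hx hxL).2, zero_mul]
  have e2 : ∫ x in Ω, h x * Θ (w x) = ∫ x in K, h x * Θ (w x) := by
    refine setIntegral_eq_of_subset_of_ae_sdiff_eq_zero hΩ.nullMeasurableSet hKΩ ?_
    filter_upwards [hzero K subset_rfl] with x hx hxL
    rw [(hx hxL).1, mul_zero]
  rwa [e1, e2] at hle

/-- The Sobolev inequality on small sets for `Θ ∘ w`. -/
lemma setLIntegral_comp_le {n : ℕ} {Ω : Set (EuclideanSpace ℝ (Fin n))} (hΩ : IsOpen Ω)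
    {C : ℝ≥0∞} (hCt : C ≠ ⊤)
    (hC : ∀ Y : EuclideanSpace ℝ (Fin n) → ℝ, ContDiff ℝ 1 Y → HasCompactSupport Y →
      ∀ A : Set (EuclideanSpace ℝ (Fin n)),
        ∫⁻ x in A, ‖Y x‖ₑ ≤ C * volume A ^ (1 / (n : ℝ)) * ∫⁻ x, ‖fderiv ℝ Y x‖ₑ)
    {P P' : ℝ≥0∞} [hPP : ENNReal.HolderConjugate P' P]
    {w : EuclideanSpace ℝ (Fin n) → ℝ}
    {Dw : EuclideanSpace ℝ (Fin n) → EuclideanSpace ℝ (Fin n)} (hw : MemLpLoc Ω ⊤ w)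
    (hDw : MemLpLoc Ω P Dw) (hg : IsWeakGradient Ω w Dw) {K : Set (EuclideanSpace ℝ (Fin n))}
    (hK : IsCompact K) (hKΩ : K ⊆ Ω) {k₀ : ℝ}
    (hout : ∀ᵐ x ∂(volume.restrict Ω), x ∉ K → w x ≤ k₀) {Θ Θ' : ℝ → ℝ}
    (hΘ : ∀ t, HasDerivAt Θ (Θ' t) t) (hΘc : Continuous Θ') (hΘ0 : ∀ t, 0 ≤ Θ t)
    (hΘk : ∀ t ≤ k₀, Θ t = 0) (hΘk' : ∀ t ≤ k₀, Θ' t = 0)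
    {A : Set (EuclideanSpace ℝ (Fin n))} (hAΩ : A ⊆ Ω) (hAt : volume A ≠ ⊤) :
    ∫⁻ x in A, ‖Θ (w x)‖ₑ ≤
      C * volume A ^ (1 / (n : ℝ)) * ∫⁻ x in K, ‖Θ' (w x)‖ₑ * ‖Dw x‖ₑ := by
  obtain ⟨K₁, Y, R, hK₁, hK₁Ω, hKK₁, hYd, hYt, hY0, hYR, hYlim, hYg⟩ := exists_test_approx hΩ
    (P' := P') hw hDw hg hK hKΩ hout hΘ hΘc hΘ0 hΘk hΘk'
  set T := ∫⁻ x in K, ‖Θ' (w x)‖ₑ * ‖Dw x‖ₑ with hT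
  set c := C * volume A ^ (1 / (n : ℝ)) with hc
  have hct : c ≠ ⊤ := ENNReal.mul_ne_top hCt
    (ENNReal.rpow_ne_top_of_nonneg (by positivity) hAt)
  have hTΩ : ∫⁻ x in Ω, ‖Θ' (w x) • Dw x‖ₑ = T := by
    simp only [enorm_smul]
    rw [hT, ← inter_eq_left.2 hKΩ, ← setLIntegral_indicator hK.measurableSet]
    refine lintegral_congr_ae ?_
    filter_upwards [hout] with x hx
    by_cases hxK : x ∈ K
    · simp [hxK]
    · simp [hxK, hΘk' _ (hx hxK)]
  have hmeas : AEMeasurable (fun x => ‖Θ' (w x) • Dw x‖ₑ) (volume.restrict Ω) := by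
    have h1 : AEMeasurable (fun x => ‖Θ' (w x) • Dw x‖ₑ) (volume.restrict K) :=
      ((hΘc.comp_aestronglyMeasurable (hw K hK hKΩ).1).smul (hDw K hK hKΩ).1).enorm
    refine AEMeasurable.congr ((aemeasurable_indicator_iff hK.measurableSet).2 h1).restrict ?_
    filter_upwards [hout] with x hx
    by_cases hxK : x ∈ K
    · simp [hxK]
    · simp [hxK, hΘk' _ (hx hxK)]
  have hone : MemLpLoc Ω P' fun _ : EuclideanSpace ℝ (Fin n) => (1 : ℝ) := by
    intro L hL _
    have : IsFiniteMeasure (volume.restrict L) := ⟨by simpa using hL.measure_lt_top⟩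
    exact memLp_const 1
  have hlim := hYg _ hone
  simp only [enorm_one, one_mul] at hlim
  have hbound : ∀ j, ∫⁻ x in A, ‖Y j x‖ₑ ≤
      c * ((∫⁻ x in Ω, ‖gradient (Y j) x - Θ' (w x) • Dw x‖ₑ) + T) := by
    intro j
    refine (hC (Y j) (hYd j) (hK₁.of_isClosed_subset (isClosed_tsupport _) (hYt j)) A).trans ?_
    gcongr
    have e1 : ∀ x, ‖fderiv ℝ (Y j) x‖ₑ = ‖gradient (Y j) x‖ₑ := fun x => by
      rw [← toDual_gradient, LinearIsometryEquiv.enorm_map]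
    rw [lintegral_congr e1]
    have e2 : ∫⁻ x, ‖gradient (Y j) x‖ₑ = ∫⁻ x in Ω, ‖gradient (Y j) x‖ₑ := by
      rw [← lintegral_indicator hΩ.measurableSet]
      refine lintegral_congr fun x => ?_
      by_cases hx : x ∈ Ω
      · simp [hx]
      · have h1 : x ∉ tsupport (fderiv ℝ (Y j)) := fun h' =>
          hx (hK₁Ω (hYt j (tsupport_fderiv_subset ℝ h')))
        have h2 : gradient (Y j) x = 0 := by
          rw [gradient, image_eq_zero_of_notMem_tsupport h1, map_zero]
        simp [hx, h2]
    rw [e2, ← hTΩ, ← lintegral_add_right' _ hmeas]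
    refine lintegral_mono fun x => ?_
    calc ‖gradient (Y j) x‖ₑ
        = ‖(gradient (Y j) x - Θ' (w x) • Dw x) + Θ' (w x) • Dw x‖ₑ := by rw [sub_add_cancel]
      _ ≤ _ := enorm_add_le _ _
  -- Fatou suffices on the left, since only an upper bound is wanted.
  have hfatou : ∫⁻ x in A, ‖Θ (w x)‖ₑ ≤ liminf (fun j => ∫⁻ x in A, ‖Y j x‖ₑ) atTop := by
    refine le_trans (lintegral_mono_ae ?_)
      (lintegral_liminf_le' fun j => (hYd j).continuous.aestronglyMeasurable.enorm)
    filter_upwards [ae_restrict_of_ae_restrict_of_subset hAΩ hYlim] with x hx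
    exact hx.enorm.liminf_eq.ge
  refine hfatou.trans ?_
  have h2 := ENNReal.Tendsto.const_mul (hlim.add_const T) (Or.inr hct)
  rw [zero_add] at h2
  rw [← h2.liminf_eq]
  exact liminf_le_liminf (Eventually.of_forall hbound)

end Consequences

/-! ### Comparison at positive levels -/

section LevelComparison

open Filter Topology

/-- Only the kink `t = k` needs an argument: there `β > 1` makes the function `o(|h|)`. This is why
truncations enter with exponents larger than `1`. -/
lemma hasDerivAt_max_rpow {β : ℝ} (hβ : 1 < β) (k t : ℝ) :
    HasDerivAt (fun t => max (t - k) 0 ^ β) (β * max (t - k) 0 ^ (β - 1)) t := by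
  rcases lt_trichotomy t k with h | rfl | h
  · have h1 : (fun t => max (t - k) 0 ^ β) =ᶠ[𝓝 t] fun _ => 0 := by
      filter_upwards [gt_mem_nhds h] with s hs
      rw [max_eq_right (by linarith), Real.zero_rpow (by linarith)]
    rw [max_eq_right (by linarith), Real.zero_rpow (by linarith), mul_zero]
    exact (hasDerivAt_const t (0 : ℝ)).congr_of_eventuallyEq h1
  · rw [sub_self, max_self, Real.zero_rpow (by linarith), mul_zero, hasDerivAt_iff_isLittleO_nhds_zero]
    have h1 : Tendsto (fun h : ℝ => |h| ^ (β - 1)) (𝓝 0) (𝓝 0) := by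
      have := (continuous_abs.tendsto (0 : ℝ)).rpow_const (p := β - 1) (Or.inr (by linarith))
      rwa [abs_zero, Real.zero_rpow (by linarith)] at this
    rw [Asymptotics.isLittleO_iff]
    intro c hc
    filter_upwards [h1.eventually_le_const hc] with h hh
    simp only [add_sub_cancel_left, sub_self, max_self, smul_zero, sub_zero]
    rw [Real.zero_rpow (by linarith), sub_zero,
      Real.norm_of_nonneg (Real.rpow_nonneg (le_max_right _ _) _), Real.norm_eq_abs]
    calc max h 0 ^ β ≤ |h| ^ β :=
          Real.rpow_le_rpow (le_max_right _ _) (max_le (le_abs_self h) (abs_nonneg h))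
            (by linarith)
      _ = |h| ^ (β - 1) * |h| := by
          conv_lhs => rw [← sub_add_cancel β 1]
          rw [Real.rpow_add_of_nonneg (abs_nonneg h) (by linarith) zero_le_one, Real.rpow_one]
      _ ≤ c * |h| := by gcongr
  · have h1 : (fun t => max (t - k) 0 ^ β) =ᶠ[𝓝 t] fun t => (t - k) ^ β := by
      filter_upwards [lt_mem_nhds h] with s hs
      rw [max_eq_left (by linarith)]
    rw [max_eq_left (by linarith)]
    have h2 := ((hasDerivAt_id t).sub_const k).rpow_const (p := β) (Or.inr hβ.le)
    simp only [id, one_mul] at h2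
    exact h2.congr_of_eventuallyEq h1

/-- A point of `closure Ω` outside the open set `Ω` lies on the frontier, at distance `0`. So `Ω`
may be replaced by its closure here, and the set is closed in a compact one. -/
lemma isCompact_infDist_frontier_ge {n : ℕ} {Ω : Set (EuclideanSpace ℝ (Fin n))}
    (hΩo : IsOpen Ω) (hΩb : Bornology.IsBounded Ω) {δ : ℝ} (hδ : 0 < δ) :
    IsCompact {x | x ∈ Ω ∧ δ ≤ Metric.infDist x (frontier Ω)} := by
  have hset : {x | x ∈ Ω ∧ δ ≤ Metric.infDist x (frontier Ω)} =
      closure Ω ∩ {x | δ ≤ Metric.infDist x (frontier Ω)} := by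
    ext x
    refine ⟨fun h => ⟨subset_closure h.1, h.2⟩, fun h => ⟨?_, h.2⟩⟩
    by_contra hx
    have hf : x ∈ frontier Ω := by
      rw [hΩo.frontier_eq]
      exact ⟨h.1, hx⟩
    have h2 : δ ≤ Metric.infDist x (frontier Ω) := h.2
    rw [Metric.infDist_zero_of_mem hf] at h2
    linarith
  rw [hset]
  exact hΩb.isCompact_closure.inter_right
    (isClosed_le continuous_const (Metric.continuous_infDist_pt _))

/-- The comparison principle for Hamiltonians whose difference is controlled by
`‖Dw‖^{r-1} + ‖Dw‖^r` where `w = u - v` is bounded away from `0`. -/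
lemma ae_nonpos_of_hamiltonian_le {n : ℕ} (hn : 0 < n) {Ω : Set (EuclideanSpace ℝ (Fin n))}
    (hΩ : IsOpen Ω) (hΩb : Bornology.IsBounded Ω)
    {a : EuclideanSpace ℝ (Fin n) → EuclideanSpace ℝ (Fin n) → EuclideanSpace ℝ (Fin n)}
    {H : EuclideanSpace ℝ (Fin n) → ℝ → EuclideanSpace ℝ (Fin n) → ℝ}
    {u v : EuclideanSpace ℝ (Fin n) → ℝ}
    {Du Dv : EuclideanSpace ℝ (Fin n) → EuclideanSpace ℝ (Fin n)} (hQ : QLe Ω a H u Du v Dv)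
    {P P' : ℝ≥0∞} [hPP : ENNReal.HolderConjugate P' P]
    (hB : MemLpLoc Ω P' fun x => a x (Du x) - a x (Dv x))
    (hh : MemLpLoc Ω 1 fun x => H x (v x) (Dv x) - H x (u x) (Du x))
    {w : EuclideanSpace ℝ (Fin n) → ℝ}
    {Dw : EuclideanSpace ℝ (Fin n) → EuclideanSpace ℝ (Fin n)} (hw : MemLpLoc Ω ⊤ w)
    (hDw : MemLpLoc Ω P Dw) (hg : IsWeakGradient Ω w Dw) {r γ : ℝ} (hr : 1 < r) (hγ : 0 < γ)
    (hDr : MemLpLoc Ω (ENNReal.ofReal r) Dw)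
    (hell : ∀ x ∈ Ω, γ * ‖Dw x‖ ^ r ≤ inner ℝ (a x (Du x) - a x (Dv x)) (Dw x))
    (hH : ∀ K : Set (EuclideanSpace ℝ (Fin n)), IsCompact K → K ⊆ Ω → ∀ k : ℝ, 0 < k →
      ∃ C : ℝ, 0 < C ∧ ∀ᵐ x ∂(volume.restrict K), k ≤ w x →
        H x (v x) (Dv x) - H x (u x) (Du x) ≤ C * (‖Dw x‖ ^ (r - 1) + ‖Dw x‖ ^ r))
    (hbd : ∀ ε : ℝ, 0 < ε → ∃ δ : ℝ, 0 < δ ∧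
      ∀ᵐ x ∂(volume.restrict Ω), Metric.infDist x (frontier Ω) < δ → w x ≤ ε) :
    ∀ᵐ x ∂(volume.restrict Ω), w x ≤ 0 := by
  have hclosed : ∀ m : ℝ, (∀ k, m < k → ∀ᵐ x ∂(volume.restrict Ω), w x ≤ k) →
      ∀ᵐ x ∂(volume.restrict Ω), w x ≤ m := by
    intro m hm
    have h1 : ∀ᵐ x ∂(volume.restrict Ω), ∀ j : ℕ, w x ≤ m + 1 / ((j : ℝ) + 1) :=
      ae_all_iff.2 fun j => hm _ (by linarith [(by positivity : (0 : ℝ) < 1 / ((j : ℝ) + 1))])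
    filter_upwards [h1] with x hx
    have h2 := (tendsto_one_div_add_atTop_nhds_zero_nat (𝕜 := ℝ)).const_add m
    rw [add_zero] at h2
    exact ge_of_tendsto' h2 hx
  -- A strictly positive level is what confines `{w > k₀}` to a compact subset of `Ω`.
  refine hclosed 0 fun k₀ hk₀ => ?_
  by_contra hcon
  obtain ⟨δ, hδ, hδw⟩ := hbd k₀ hk₀
  set K := {x | x ∈ Ω ∧ δ ≤ Metric.infDist x (frontier Ω)} with hKdef
  have hK : IsCompact K := isCompact_infDist_frontier_ge hΩ hΩb hδ
  have hKΩ : K ⊆ Ω := fun x hx => hx.1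
  have hKm := hK.measurableSet
  have hout : ∀ᵐ x ∂(volume.restrict Ω), x ∉ K → w x ≤ k₀ := by
    filter_upwards [hδw, ae_restrict_mem hΩ.measurableSet] with x hx hxΩ hxK
    exact hx (not_le.1 fun h => hxK ⟨hxΩ, h⟩)
  have : IsFiniteMeasure (volume.restrict K) := ⟨by simpa using hK.measure_lt_top⟩
  have hglue : ∀ k, k₀ ≤ k → (∀ᵐ x ∂(volume.restrict K), w x ≤ k) →
      ∀ᵐ x ∂(volume.restrict Ω), w x ≤ k := by
    intro k hk hwk
    filter_upwards [ae_restrict_of_ae ((ae_restrict_iff' hKm).1 hwk), hout] with x h1 h2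
    by_cases hx : x ∈ K
    · exact h1 hx
    · exact (h2 hx).trans hk
  have hwK := hw K hK hKΩ
  -- The least essential upper bound among levels at least `k₀`; it is attained by `hclosed`, so the
  -- failure of `w ≤ k₀` gives `k₀ < M`.
  set S := {k | k₀ ≤ k ∧ ∀ᵐ x ∂(volume.restrict Ω), w x ≤ k} with hS
  have hSne : S.Nonempty := by
    refine ⟨max k₀ (eLpNorm w ⊤ (volume.restrict K)).toReal, le_max_left _ _,
      hglue _ (le_max_left _ _) ?_⟩
    filter_upwards [MemLp.ae_norm_le_toReal hwK] with x hx
    exact (le_abs_self _).trans (hx.trans (le_max_right _ _))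
  have hSbdd : BddBelow S := ⟨k₀, fun k hk => hk.1⟩
  set M := sInf S with hM
  have hwM : ∀ᵐ x ∂(volume.restrict Ω), w x ≤ M := by
    refine hclosed M fun k hk => ?_
    obtain ⟨k', hk', hlt⟩ := exists_lt_of_csInf_lt hSne hk
    filter_upwards [hk'.2] with x hx
    linarith
  have hk₀M : k₀ < M := by
    refine lt_of_le_of_ne (le_csInf hSne fun k hk => hk.1) fun he => hcon ?_
    rw [he]
    exact hwM
  obtain ⟨C, hC0, hC⟩ := hH K hK hKΩ k₀ hk₀
  obtain ⟨CS, hCSt, hCS⟩ := exists_setLIntegral_le_lintegral_fderiv hn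
  have hDrK := hDr K hK hKΩ
  have hDK := hDw K hK hKΩ
  have hBK := hB K hK hKΩ
  have hhK : IntegrableOn (fun x => H x (v x) (Dv x) - H x (u x) (Du x)) K :=
    memLp_one_iff_integrable.1 (hh K hK hKΩ)
  have hr0 : 0 < r := by linarith
  have hdm : AEMeasurable (fun x => ‖Dw x‖) (volume.restrict K) := hDK.1.norm.aemeasurable
  have hwm : AEMeasurable w (volume.restrict K) := hwK.1.aemeasurable
  have hdr : Integrable (fun x => ‖Dw x‖ ^ r) (volume.restrict K) := by
    have := hDrK.integrable_norm_rpow (by simpa using hr0) ENNReal.ofReal_ne_top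
    rwa [ENNReal.toReal_ofReal hr0.le] at this
  have hdr1 : Integrable (fun x => ‖Dw x‖ ^ (r - 1)) (volume.restrict K) := by
    refine Integrable.mono' ((integrable_const (1 : ℝ)).add hdr)
      (hdm.pow_const _).aestronglyMeasurable (Eventually.of_forall fun x => ?_)
    have h0 := norm_nonneg (Dw x)
    have h1 := Real.rpow_nonneg h0 r
    rw [Real.norm_of_nonneg (Real.rpow_nonneg h0 _)]
    simp only [Pi.add_apply]
    rcases le_total ‖Dw x‖ 1 with h | h
    · linarith [Real.rpow_le_one h0 h (by linarith : 0 ≤ r - 1)]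
    · linarith [Real.rpow_le_rpow_of_exponent_le h (by linarith : r - 1 ≤ r)]
  have hwMK : ∀ᵐ x ∂(volume.restrict K), w x ≤ M := ae_restrict_of_ae_restrict_of_subset hKΩ hwM
  have hs0 : ∀ k x, 0 ≤ max (w x - k) 0 := fun k x => le_max_right _ _
  have hsm : ∀ k α : ℝ, AEStronglyMeasurable (fun x => max (w x - k) 0 ^ α)
      (volume.restrict K) := fun k α => AEMeasurable.aestronglyMeasurable (by fun_prop)
  have hsb : ∀ k α : ℝ, k < M → 0 ≤ α →
      ∀ᵐ x ∂(volume.restrict K), ‖max (w x - k) 0 ^ α‖ ≤ (M - k) ^ α := by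
    intro k α hk hα
    filter_upwards [hwMK] with x hx
    rw [Real.norm_of_nonneg (Real.rpow_nonneg (hs0 k x) _)]
    exact Real.rpow_le_rpow (hs0 k x) (max_le (by linarith) (by linarith)) hα
  have hΘk : ∀ k β : ℝ, k₀ ≤ k → 0 < β → ∀ t ≤ k₀, max (t - k) 0 ^ β = (0 : ℝ) := by
    intro k β hk hβ t ht
    rw [max_eq_right (by linarith), Real.zero_rpow hβ.ne']
  have hΘcont : ∀ k β : ℝ, 0 < β → Continuous fun t : ℝ => (β + 1) * max (t - k) 0 ^ β := by
    intro k β hβ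
    have h1 : Continuous fun t : ℝ => max (t - k) 0 := by fun_prop
    exact continuous_const.mul (h1.rpow_const fun _ => Or.inr hβ.le)
  have hΘd : ∀ k β : ℝ, 0 < β → ∀ t, HasDerivAt (fun t : ℝ => max (t - k) 0 ^ (β + 1))
      ((β + 1) * max (t - k) 0 ^ β) t := by
    intro k β hβ t
    have := hasDerivAt_max_rpow (by linarith : 1 < β + 1) k t
    rwa [add_sub_cancel_right] at this
  -- The factor `2` in `c` and the factor `r + 1` in `S` come from differentiating `(w-k)₊²` and
  -- `(w-k)₊^(r+1)`, the functions used for the energy and the Sobolev inequality.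
  refine absurd (exists_ae_le_lt_of_level_estimates (volume.restrict K)
    (w := w) (d := fun x => ‖Dw x‖) (r := r) (k₀ := k₀) (M := M) (c := 2 * γ / C)
    (S := CS.toReal * (r + 1)) (θ := 1 / (n : ℝ)) hr hwm hdm (fun x => norm_nonneg _) hdr hwMK hk₀M
    (by positivity) (by positivity) (by positivity) ?_ ?_) ?_
  · intro k hk hkM
    have h1 := hQ.integral_comp_le hΩ hB hh hw hDw hg hK hKΩ hout (hΘd k 1 one_pos)
      (hΘcont k 1 one_pos) (fun t => Real.rpow_nonneg (le_max_right _ _) _)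
      (hΘk k _ hk (by norm_num)) (fun t ht => by rw [hΘk k 1 hk one_pos t ht, mul_zero])
    norm_num only [Real.rpow_one] at h1
    simp only [Real.rpow_two] at h1
    have hi1 := (MemLp.integrable_inner hBK hDK).bdd_mul (hsm k 1) (hsb k 1 hkM zero_le_one)
    have hi2 := hhK.mul_bdd (hsm k 2) (hsb k 2 hkM zero_le_two)
    have hi3 := ((hdr1.add hdr).const_mul C).mul_bdd (hsm k 2) (hsb k 2 hkM zero_le_two)
    simp only [Real.rpow_one, Real.rpow_two, Pi.add_apply] at hi1 hi2 hi3
    have h2 : 2 * γ * ∫ x in K, max (w x - k) 0 * ‖Dw x‖ ^ r ≤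
        ∫ x in K, 2 * max (w x - k) 0 * inner ℝ (a x (Du x) - a x (Dv x)) (Dw x) := by
      rw [← integral_const_mul]
      refine integral_mono_of_nonneg (Eventually.of_forall fun x => ?_) ?_ ?_
      · have := hs0 k x
        simp only [Pi.zero_apply]
        positivity
      · simpa only [mul_assoc] using hi1.const_mul 2
      · filter_upwards [ae_restrict_mem hKm] with x hx
        have := hell x (hKΩ hx)
        have := hs0 k x
        calc 2 * γ * (max (w x - k) 0 * ‖Dw x‖ ^ r)
            = 2 * max (w x - k) 0 * (γ * ‖Dw x‖ ^ r) := by ring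
          _ ≤ _ := by gcongr
    have h3 : ∫ x in K, (H x (v x) (Dv x) - H x (u x) (Du x)) * max (w x - k) 0 ^ 2 ≤
        C * ∫ x in K, (‖Dw x‖ ^ (r - 1) + ‖Dw x‖ ^ r) * max (w x - k) 0 ^ 2 := by
      rw [← integral_const_mul]
      simp only [← mul_assoc]
      refine integral_mono_ae hi2 hi3 ?_
      filter_upwards [hC] with x hx
      rcases le_total (w x) k with h | h
      · simp [max_eq_right (sub_nonpos.2 h)]
      · have := hx (hk.trans h)
        gcongr
    rw [div_mul_eq_mul_div, div_le_iff₀ hC0]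
    linarith [h2.trans (h1.trans h3)]
  · intro k hk hkM A
    have hfin : volume (A ∩ K) ≠ ⊤ :=
      ((measure_mono inter_subset_right).trans_lt hK.measure_lt_top).ne
    have h1 := setLIntegral_comp_le hΩ hCSt hCS (P := P) (P' := P') hw hDw hg hK hKΩ hout
      (hΘd k r hr0) (hΘcont k r hr0) (fun t => Real.rpow_nonneg (le_max_right _ _) _)
      (hΘk k _ hk (by linarith)) (fun t ht => by rw [hΘk k r hk hr0 t ht, mul_zero])
      (A := A ∩ K) (inter_subset_right.trans hKΩ) hfin
    have hDi : Integrable (fun x => (r + 1) * max (w x - k) 0 ^ r * ‖Dw x‖)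
        (volume.restrict K) := by
      have hP1 : 1 ≤ P := ENNReal.HolderConjugate.one_le P P'
      have hD1 : Integrable Dw (volume.restrict K) :=
        memLp_one_iff_integrable.1 (hDK.mono_exponent hP1)
      simpa only [mul_assoc] using
        (hD1.norm.bdd_mul (hsm k r) (hsb k r hkM hr0.le)).const_mul (r + 1)
    have hcomm : ∀ x, ‖(r + 1) * max (w x - k) 0 ^ r‖ₑ * ‖Dw x‖ₑ =
        ‖(r + 1) * max (w x - k) 0 ^ r * ‖Dw x‖‖ₑ := fun x => by
      rw [enorm_mul _ ‖Dw x‖, enorm_norm]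
    rw [lintegral_congr hcomm] at h1
    rw [Measure.restrict_restrict' hKm]
    have hrhs : CS * volume (A ∩ K) ^ (1 / (n : ℝ)) *
        ∫⁻ x in K, ‖(r + 1) * max (w x - k) 0 ^ r * ‖Dw x‖‖ₑ ≠ ⊤ :=
      ENNReal.mul_ne_top (ENNReal.mul_ne_top hCSt
        (ENNReal.rpow_ne_top_of_nonneg (by positivity) hfin)) hDi.2.ne
    have h2 := ENNReal.toReal_mono hrhs h1
    rw [ENNReal.toReal_mul, ENNReal.toReal_mul, ← ENNReal.toReal_rpow,
      ← integral_norm_eq_lintegral_enorm hDi.1,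
      ← integral_norm_eq_lintegral_enorm
        ((hsm k (r + 1)).mono_measure (Measure.restrict_mono inter_subset_right le_rfl))] at h2
    have e1 : ∀ x, ‖max (w x - k) 0 ^ (r + 1)‖ = max (w x - k) 0 ^ (r + 1) := fun x =>
      Real.norm_of_nonneg (Real.rpow_nonneg (hs0 k x) _)
    have e2 : ∀ x, ‖(r + 1) * max (w x - k) 0 ^ r * ‖Dw x‖‖ =
        (r + 1) * (max (w x - k) 0 ^ r * ‖Dw x‖) := fun x => by
      rw [mul_assoc, Real.norm_of_nonneg]
      have := Real.rpow_nonneg (hs0 k x) r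
      positivity
    simp only [e1, e2, integral_const_mul] at h2
    refine h2.trans_eq ?_
    rw [measureReal_restrict_apply' hKm]
    simp only [Measure.real]
    ring
  · rintro ⟨k, hk, hkM, hwk⟩
    have := csInf_le hSbdd (show k ∈ S from ⟨hk, hglue k hk hwk⟩)
    linarith

end LevelComparison

/-! ### Estimates for the special Hamiltonian -/

section Hamiltonian

open Filter Topology

/-- The increment is continuous and positive on the compact set of `(x, s, t)` with `|s|, |t| ≤ R`
and `s - t ≥ k`, so it attains a positive minimum. -/
lemma exists_uniform_gap_of_strictMono {X : Type*} [TopologicalSpace X] {f : X → ℝ → ℝ}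
    {Ω K : Set X} (hf : ContinuousOn (Function.uncurry f) (Ω ×ˢ (univ : Set ℝ)))
    (hfs : ∀ x ∈ Ω, StrictMono (f x)) (hK : IsCompact K) (hKΩ : K ⊆ Ω) (R : ℝ) {k : ℝ}
    (hk : 0 < k) :
    ∃ c : ℝ, 0 < c ∧ ∀ x ∈ K, ∀ s t : ℝ, |s| ≤ R → |t| ≤ R → k ≤ s - t → f x t + c ≤ f x s := by
  set T : Set (X × ℝ × ℝ) := (K ×ˢ (Icc (-R) R ×ˢ Icc (-R) R)) ∩ {z | k ≤ z.2.1 - z.2.2} with hT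
  have hTc : IsCompact T := (hK.prod (isCompact_Icc.prod isCompact_Icc)).inter_right
    (isClosed_le continuous_const (by fun_prop))
  have h1 : ContinuousOn (fun z : X × ℝ × ℝ => f z.1 z.2.1) T :=
    hf.comp (f := fun z : X × ℝ × ℝ => (z.1, z.2.1)) (by fun_prop)
      fun z hz => ⟨hKΩ hz.1.1, mem_univ _⟩
  have h2 : ContinuousOn (fun z : X × ℝ × ℝ => f z.1 z.2.2) T :=
    hf.comp (f := fun z : X × ℝ × ℝ => (z.1, z.2.2)) (by fun_prop)
      fun z hz => ⟨hKΩ hz.1.1, mem_univ _⟩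
  rcases T.eq_empty_or_nonempty with he | hne
  · refine ⟨1, one_pos, fun x hx s t hs ht hst => ?_⟩
    have : (x, s, t) ∈ T := ⟨⟨hx, abs_le.1 hs, abs_le.1 ht⟩, hst⟩
    rw [he] at this
    exact this.elim
  · obtain ⟨z, hz, hmin⟩ := hTc.exists_isMinOn hne (h1.sub h2)
    have hzk : k ≤ z.2.1 - z.2.2 := hz.2
    refine ⟨f z.1 z.2.1 - f z.1 z.2.2, sub_pos.2 (hfs _ (hKΩ hz.1.1) (by linarith)),
      fun x hx s t hs ht hst => ?_⟩
    have h3 := hmin (show (x, s, t) ∈ T from ⟨⟨hx, abs_le.1 hs, abs_le.1 ht⟩, hst⟩)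
    simp only [mem_ofPred_eq, Pi.sub_apply] at h3
    linarith

lemma exists_abs_le_of_continuousOn {X : Type*} [TopologicalSpace X] {f : X → ℝ → ℝ}
    {Ω K : Set X} (hf : ContinuousOn (Function.uncurry f) (Ω ×ˢ (univ : Set ℝ)))
    (hK : IsCompact K) (hKΩ : K ⊆ Ω) (R : ℝ) :
    ∃ G : ℝ, 0 ≤ G ∧ ∀ x ∈ K, ∀ t : ℝ, |t| ≤ R → |f x t| ≤ G := by
  obtain ⟨G, hG⟩ := (hK.prod (isCompact_Icc (a := -R) (b := R))).exists_bound_of_continuousOn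
    (hf.mono (prod_mono hKΩ (subset_univ _)))
  refine ⟨max G 0, le_max_right _ _, fun x hx t ht => ?_⟩
  exact (hG (x, t) ⟨hx, abs_le.1 ht⟩).trans (le_max_left _ _)

/-- Replacing the larger of `A`, `B` by the smaller one, `m`, costs at most `c m ^ σ` plus a
multiple of `e ^ σ`; the gap `α - β ≥ c` pays for the first term, whatever the signs of `α` and `β`.
-/
lemma mul_rpow_sub_mul_rpow_le {σ G C c ε α β A B e : ℝ} (hσ : 0 < σ) (hG : 0 ≤ G) (hC : 0 ≤ C)
    (hε : G * ε ≤ c)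
    (hpow : ∀ m e : ℝ, 0 ≤ m → 0 ≤ e → (m + e) ^ σ ≤ (1 + ε) * m ^ σ + C * e ^ σ)
    (hα : |α| ≤ G) (hβ : |β| ≤ G) (hgap : β + c ≤ α) (hA : 0 ≤ A) (hB : 0 ≤ B)
    (he : |A - B| ≤ e) :
    β * B ^ σ - α * A ^ σ ≤ G * C * e ^ σ := by
  have he0 : 0 ≤ e := (abs_nonneg _).trans he
  have hes : 0 ≤ e ^ σ := Real.rpow_nonneg he0 σ
  -- Used with `g = β` if `A ≤ B` and with `g = -α` if `B ≤ A`.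
  have key : ∀ m N g : ℝ, 0 ≤ m → m ≤ N → N - m ≤ e → |g| ≤ G →
      g * (N ^ σ - m ^ σ) ≤ c * m ^ σ + G * C * e ^ σ := by
    intro m N g hm hmN hNe hg
    have h1 := hpow m (N - m) hm (by linarith)
    rw [add_sub_cancel] at h1
    have h2 : (N - m) ^ σ ≤ e ^ σ := Real.rpow_le_rpow (by linarith) hNe hσ.le
    have h3 : 0 ≤ N ^ σ - m ^ σ := sub_nonneg.2 (Real.rpow_le_rpow hm hmN hσ.le)
    have h4 : 0 ≤ m ^ σ := Real.rpow_nonneg hm σ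
    calc g * (N ^ σ - m ^ σ) ≤ G * (N ^ σ - m ^ σ) := by
          gcongr
          exact (le_abs_self g).trans hg
      _ ≤ G * (ε * m ^ σ + C * e ^ σ) := by
          gcongr
          have : C * (N - m) ^ σ ≤ C * e ^ σ := by gcongr
          linarith
      _ = (G * ε) * m ^ σ + G * C * e ^ σ := by ring
      _ ≤ _ := by gcongr
  have hAs := Real.rpow_nonneg hA σ
  have hBs := Real.rpow_nonneg hB σ
  rcases le_total A B with h | h
  · have h1 := key A B β hA h (by rw [abs_le] at he; linarith [he.1]) hβ
    nlinarith
  · have h1 := key B A (-α) hB h (by rw [abs_le] at he; linarith [he.2]) (by rwa [abs_neg])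
    nlinarith

/-- Reduces the gradient terms to a power of `‖ξ - η‖` alone, with no growth left in `ξ` or `η`
separately. -/
lemma exists_specialHamiltonian_sub_le {n : ℕ} {Ω K : Set (EuclideanSpace ℝ (Fin n))} {σ : ℝ}
    (hσ : 0 < σ) {f g : EuclideanSpace ℝ (Fin n) → ℝ → ℝ}
    (hg : ContinuousOn (Function.uncurry g) (Ω ×ˢ (univ : Set ℝ)))
    (hgm : ∀ x ∈ Ω, Monotone (g x)) (hcase : σ ≤ 1 ∨ ∀ x ∈ Ω, StrictMono (g x))
    (hK : IsCompact K) (hKΩ : K ⊆ Ω) (R : ℝ) {k : ℝ} (hk : 0 < k) :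
    ∃ C : ℝ, 0 < C ∧ ∀ x ∈ K, ∀ s t : ℝ, |s| ≤ R → |t| ≤ R → k ≤ s - t →
      ∀ ξ η : EuclideanSpace ℝ (Fin n),
        specialHamiltonian f g σ x t η - specialHamiltonian f g σ x s ξ ≤
          f x t - f x s + C * ‖ξ - η‖ ^ σ := by
  obtain ⟨G, hG0, hG⟩ := exists_abs_le_of_continuousOn hg hK hKΩ R
  obtain ⟨C, c, ε, hC, hε, hpow, hgap⟩ : ∃ C c ε : ℝ, 0 ≤ C ∧ G * ε ≤ c ∧
      (∀ m e : ℝ, 0 ≤ m → 0 ≤ e → (m + e) ^ σ ≤ (1 + ε) * m ^ σ + C * e ^ σ) ∧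
      ∀ x ∈ K, ∀ s t : ℝ, |s| ≤ R → |t| ≤ R → k ≤ s - t → g x t + c ≤ g x s := by
    -- For `σ ≤ 1` subadditivity allows `ε = c = 0`. Otherwise `ε` is tuned to the gap, with `G + 1`
    -- guarding against `G = 0`.
    rcases hcase with hσ1 | hgs
    · refine ⟨1, 0, 0, zero_le_one, by simp, fun m e hm he => ?_, fun x hx s t _ _ hst => ?_⟩
      · simpa using Real.rpow_add_le_add_rpow hm he hσ.le hσ1
      · rw [add_zero]
        exact hgm x (hKΩ hx) (by linarith)
    · obtain ⟨c, hc, hgap⟩ := exists_uniform_gap_of_strictMono hg hgs hK hKΩ R hk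
      obtain ⟨C, hC, hpow⟩ := exists_add_rpow_le hσ (ε := c / (G + 1)) (by positivity)
      refine ⟨C, c, c / (G + 1), hC.le, ?_, hpow, hgap⟩
      rw [mul_div_assoc', div_le_iff₀ (by positivity)]
      nlinarith
  refine ⟨G * C + 1, by positivity, fun x hx s t hs ht hst ξ η => ?_⟩
  have h1 := mul_rpow_sub_mul_rpow_le hσ hG0 hC hε hpow (hG x hx s hs) (hG x hx t ht)
    (hgap x hx s t hs ht hst) (norm_nonneg ξ) (norm_nonneg η) (abs_norm_sub_norm_le ξ η)
  have h2 : 0 ≤ ‖ξ - η‖ ^ σ := Real.rpow_nonneg (norm_nonneg _) σ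
  simp only [specialHamiltonian]
  linarith

/-- Continuity is only available on `Ω × ℝ`, so `f` is extended by zero off `K × ℝ` to a Borel
function before composing. -/
lemma aestronglyMeasurable_comp_of_continuousOn {n : ℕ} {Ω K : Set (EuclideanSpace ℝ (Fin n))}
    {f : EuclideanSpace ℝ (Fin n) → ℝ → ℝ}
    (hf : ContinuousOn (Function.uncurry f) (Ω ×ˢ (univ : Set ℝ))) (hK : MeasurableSet K)
    (hKΩ : K ⊆ Ω) {u : EuclideanSpace ℝ (Fin n) → ℝ}
    (hu : AEStronglyMeasurable u (volume.restrict K)) :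
    AEStronglyMeasurable (fun x => f x (u x)) (volume.restrict K) := by
  classical
  have h1 : Measurable ((K ×ˢ (univ : Set ℝ)).piecewise (Function.uncurry f) fun _ => 0) :=
    (hf.mono (prod_mono hKΩ subset_rfl)).measurable_piecewise continuousOn_const
      (hK.prod MeasurableSet.univ)
  have h2 : AEMeasurable (fun x => (x, u x)) (volume.restrict K) :=
    aemeasurable_id.prodMk hu.aemeasurable
  refine (h1.comp_aemeasurable h2).aestronglyMeasurable.congr ?_
  filter_upwards [ae_restrict_mem hK] with x hx
  have : (x, u x) ∈ K ×ˢ (univ : Set ℝ) := ⟨hx, mem_univ _⟩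
  simp [Function.comp, hx]

lemma memLpLoc_specialHamiltonian {n : ℕ} {Ω : Set (EuclideanSpace ℝ (Fin n))} {σ : ℝ}
    (hσ : 0 < σ) {f g : EuclideanSpace ℝ (Fin n) → ℝ → ℝ}
    (hf : ContinuousOn (Function.uncurry f) (Ω ×ˢ (univ : Set ℝ)))
    (hg : ContinuousOn (Function.uncurry g) (Ω ×ˢ (univ : Set ℝ)))
    {u : EuclideanSpace ℝ (Fin n) → ℝ}
    {Du : EuclideanSpace ℝ (Fin n) → EuclideanSpace ℝ (Fin n)} (hu : MemLpLoc Ω ⊤ u)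
    (hDu : MemLpLoc Ω (ENNReal.ofReal σ) Du) :
    MemLpLoc Ω 1 fun x => specialHamiltonian f g σ x (u x) (Du x) := by
  intro K hK hKΩ
  have : IsFiniteMeasure (volume.restrict K) := ⟨by simpa using hK.measure_lt_top⟩
  have huK := hu K hK hKΩ
  obtain ⟨F, -, hF⟩ := exists_abs_le_of_continuousOn hf hK hKΩ
    (eLpNorm u ⊤ (volume.restrict K)).toReal
  obtain ⟨G, -, hG⟩ := exists_abs_le_of_continuousOn hg hK hKΩ
    (eLpNorm u ⊤ (volume.restrict K)).toReal
  have hfm := aestronglyMeasurable_comp_of_continuousOn hf hK.measurableSet hKΩ huK.1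
  have hgm := aestronglyMeasurable_comp_of_continuousOn hg hK.measurableSet hKΩ huK.1
  have hDi : Integrable (fun x => ‖Du x‖ ^ σ) (volume.restrict K) := by
    have := (hDu K hK hKΩ).integrable_norm_rpow (by simpa using hσ) ENNReal.ofReal_ne_top
    rwa [ENNReal.toReal_ofReal hσ.le] at this
  rw [memLp_one_iff_integrable]
  refine Integrable.add (Integrable.mono' (integrable_const F) hfm ?_)
    (hDi.bdd_mul (c := G) hgm ?_)
  · filter_upwards [MemLp.ae_norm_le_toReal huK, ae_restrict_mem hK.measurableSet] with x hx hxK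
    exact hF x hxK _ hx
  · filter_upwards [MemLp.ae_norm_le_toReal huK, ae_restrict_mem hK.measurableSet] with x hx hxK
    exact hG x hxK _ hx

lemma IsWeakGradient.sub {n : ℕ} {Ω : Set (EuclideanSpace ℝ (Fin n))} (hΩ : MeasurableSet Ω)
    {u v : EuclideanSpace ℝ (Fin n) → ℝ}
    {Du Dv : EuclideanSpace ℝ (Fin n) → EuclideanSpace ℝ (Fin n)}
    (hu : MemLpLoc Ω 1 u) (hv : MemLpLoc Ω 1 v) (hDu : MemLpLoc Ω 1 Du) (hDv : MemLpLoc Ω 1 Dv)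
    (h : IsWeakGradient Ω u Du) (h' : IsWeakGradient Ω v Dv) :
    IsWeakGradient Ω (fun x => u x - v x) fun x => Du x - Dv x := by
  intro φ hφ hφc hφΩ
  have hgc : Continuous (gradient φ) :=
    (InnerProductSpace.toDual ℝ _).symm.continuous.comp (hφ.continuous_fderiv (by simp))
  have hg0 : ∀ x, x ∉ tsupport φ → gradient φ x = 0 := by
    intro x hx
    have : x ∉ tsupport (fderiv ℝ φ) := fun h' => hx (tsupport_fderiv_subset ℝ h')
    rw [gradient, image_eq_zero_of_notMem_tsupport this, map_zero]
  have hgs : HasCompactSupport (gradient φ) := HasCompactSupport.intro hφc fun x hx => hg0 x hx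
  obtain ⟨C, hC⟩ := hgs.exists_bound_of_continuous hgc
  obtain ⟨C', hC'⟩ := hφc.exists_bound_of_continuous hφ.continuous
  have h1 : ∀ z : EuclideanSpace ℝ (Fin n) → ℝ, MemLpLoc Ω 1 z →
      IntegrableOn (fun x => z x • gradient φ x) Ω := by
    intro z hz
    have hzi : IntegrableOn z (tsupport φ) := memLp_one_iff_integrable.1 (hz _ hφc hφΩ)
    have hK : IntegrableOn (fun x => z x • gradient φ x) (tsupport φ) :=
      Integrable.smul_bdd hzi C hgc.aestronglyMeasurable (Eventually.of_forall hC)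
    refine hK.of_ae_sdiff_eq_zero hΩ.nullMeasurableSet (Eventually.of_forall fun x hx => ?_)
    rw [hg0 x hx.2, smul_zero]
  have h2 : ∀ Z : EuclideanSpace ℝ (Fin n) → EuclideanSpace ℝ (Fin n), MemLpLoc Ω 1 Z →
      IntegrableOn (fun x => φ x • Z x) Ω := by
    intro Z hZ
    have hZi : IntegrableOn Z (tsupport φ) := memLp_one_iff_integrable.1 (hZ _ hφc hφΩ)
    have hK : IntegrableOn (fun x => φ x • Z x) (tsupport φ) :=
      Integrable.bdd_smul hZi C' hφ.continuous.aestronglyMeasurable (Eventually.of_forall hC')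
    refine hK.of_ae_sdiff_eq_zero hΩ.nullMeasurableSet (Eventually.of_forall fun x hx => ?_)
    rw [image_eq_zero_of_notMem_tsupport hx.2, zero_smul]
  simp only [sub_smul, smul_sub]
  rw [integral_sub (h1 u hu) (h1 v hv), integral_sub (h2 Du hDu) (h2 Dv hDv), h φ hφ hφc hφΩ,
    h' φ hφ hφc hφΩ]
  abel

end Hamiltonian

/-! ### The comparison principle for the special Hamiltonian -/

/-- Isolates what varies between the cases: the dual pair `P`, `P'`, the ellipticity exponent `r`,
and the bound of `f(x,v) - f(x,u) + C₀|Dw|^σ` by the powers `r - 1` and `r` of `|Dw|`. -/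
lemma ae_le_of_specialHamiltonian {n : ℕ} (hn : 0 < n) {Ω : Set (EuclideanSpace ℝ (Fin n))}
    (hΩo : IsOpen Ω) (hΩb : Bornology.IsBounded Ω) {p q σ : ℝ} (hσ : 0 < σ)
    {a : EuclideanSpace ℝ (Fin n) → EuclideanSpace ℝ (Fin n) → EuclideanSpace ℝ (Fin n)}
    (hae : IsEllipticField Ω p q a) {f g : EuclideanSpace ℝ (Fin n) → ℝ → ℝ}
    (hf : ContinuousOn (Function.uncurry f) (Ω ×ˢ (univ : Set ℝ)))
    (hg : ContinuousOn (Function.uncurry g) (Ω ×ˢ (univ : Set ℝ)))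
    (hgm : ∀ x ∈ Ω, Monotone (g x)) {u v : EuclideanSpace ℝ (Fin n) → ℝ}
    {Du Dv : EuclideanSpace ℝ (Fin n) → EuclideanSpace ℝ (Fin n)} {P P' : ℝ≥0∞}
    [hPP : ENNReal.HolderConjugate P' P] (hu : MemW1Loc Ω P u Du) (hv : MemW1Loc Ω P v Dv)
    (hub : MemLpLoc Ω ⊤ u) (hvb : MemLpLoc Ω ⊤ v) (hau : MemLpLoc Ω P' fun x => a x (Du x))
    (hav : MemLpLoc Ω P' fun x => a x (Dv x)) (hcase : σ ≤ 1 ∨ ∀ x ∈ Ω, StrictMono (g x))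
    (hσP : ENNReal.ofReal σ ≤ P) {r : ℝ} (hr : r ∈ Icc (max 2 q) p) (hrP : ENNReal.ofReal r ≤ P)
    (hbound : ∀ K : Set (EuclideanSpace ℝ (Fin n)), IsCompact K → K ⊆ Ω → ∀ R k C₀ : ℝ, 0 < k →
      0 < C₀ → ∃ C : ℝ, 0 < C ∧ ∀ᵐ x ∂(volume.restrict K), |u x| ≤ R → |v x| ≤ R →
        k ≤ u x - v x → f x (v x) - f x (u x) + C₀ * ‖Du x - Dv x‖ ^ σ ≤
          C * (‖Du x - Dv x‖ ^ (r - 1) + ‖Du x - Dv x‖ ^ r))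
    (hQ : QLe Ω a (specialHamiltonian f g σ) u Du v Dv) (hbd : LeOnBoundary Ω u v) :
    ∀ᵐ x ∂(volume.restrict Ω), u x ≤ v x := by
  obtain ⟨γ, hγ, hell⟩ := hae
  have hP1 : 1 ≤ P := ENNReal.HolderConjugate.one_le P P'
  have hr2 : 2 ≤ r := (le_max_left _ _).trans hr.1
  have hDw : MemLpLoc Ω P fun x => Du x - Dv x := fun K hK hKΩ =>
    (hu.memLp_grad K hK hKΩ).sub (hv.memLp_grad K hK hKΩ)
  have hw0 : ∀ᵐ x ∂(volume.restrict Ω), u x - v x ≤ 0 := by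
    refine ae_nonpos_of_hamiltonian_le hn hΩo hΩb hQ (P := P) (P' := P') (r := r)
      (Dw := fun x => Du x - Dv x)
      (fun K hK hKΩ => (hau K hK hKΩ).sub (hav K hK hKΩ))
      (fun K hK hKΩ => MemLp.sub
        (memLpLoc_specialHamiltonian hσ hf hg hvb (hv.memLp_grad.mono_exponent hσP) K hK hKΩ)
        (memLpLoc_specialHamiltonian hσ hf hg hub (hu.memLp_grad.mono_exponent hσP) K hK hKΩ))
      (fun K hK hKΩ => (hub K hK hKΩ).sub (hvb K hK hKΩ)) hDw
      (hu.weakGradient.sub hΩo.measurableSet (hu.memLp.mono_exponent hP1)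
        (hv.memLp.mono_exponent hP1) (hu.memLp_grad.mono_exponent hP1)
        (hv.memLp_grad.mono_exponent hP1) hv.weakGradient)
      (by linarith) hγ (hDw.mono_exponent hrP) (fun x hx => hell r hr x hx _ _) ?_ hbd
    intro K hK hKΩ k hk
    set R := max (eLpNorm u ⊤ (volume.restrict K)).toReal (eLpNorm v ⊤ (volume.restrict K)).toReal
    obtain ⟨C₀, hC₀, hH⟩ := exists_specialHamiltonian_sub_le (f := f) hσ hg hgm hcase hK hKΩ R hk
    obtain ⟨C, hC, hCb⟩ := hbound K hK hKΩ R k C₀ hk hC₀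
    refine ⟨C, hC, ?_⟩
    filter_upwards [hCb, MemLp.ae_norm_le_toReal (hub K hK hKΩ),
      MemLp.ae_norm_le_toReal (hvb K hK hKΩ), ae_restrict_mem hK.measurableSet]
      with x hx hxu hxv hxK hkx
    have h1 : |u x| ≤ R := hxu.trans (le_max_left _ _)
    have h2 : |v x| ≤ R := hxv.trans (le_max_right _ _)
    exact (hH x hxK _ _ h1 h2 hkx _ _).trans (hx h1 h2 hkx)
  filter_upwards [hw0] with x hx
  linarith

theorem mainTheorem4 {n : ℕ} (hn : 0 < n)
    (Ω : Set (EuclideanSpace ℝ (Fin n))) (hΩo : IsOpen Ω) (hΩb : Bornology.IsBounded Ω)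
    (p q σ : ℝ) (hp : 2 ≤ p) (hq : 1 < q) (hqp : q ≤ p)
    (a : EuclideanSpace ℝ (Fin n) → EuclideanSpace ℝ (Fin n) → EuclideanSpace ℝ (Fin n))
    (ha : IsCaratheodory Ω a) (hae : IsEllipticField Ω p q a)
    (f g : EuclideanSpace ℝ (Fin n) → ℝ → ℝ)
    (hf : ContinuousOn (Function.uncurry f) (Ω ×ˢ (Set.univ : Set ℝ)))
    (hg : ContinuousOn (Function.uncurry g) (Ω ×ˢ (Set.univ : Set ℝ)))
    (hfm : ∀ x ∈ Ω, Monotone (f x)) (hgm : ∀ x ∈ Ω, Monotone (g x))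
    (u v : EuclideanSpace ℝ (Fin n) → ℝ)
    (Du Dv : EuclideanSpace ℝ (Fin n) → EuclideanSpace ℝ (Fin n))
    (hcases :
      -- `u, v ∈ W^{1,p}_loc ∩ L^∞_loc`, the integrals in `Qu ≤ Qv` are well defined,
      -- and one of the four cases A₁, A₂ₐ, A₂b, A₃ holds
      ((MemW1Loc Ω (ENNReal.ofReal p) u Du ∧ MemW1Loc Ω (ENNReal.ofReal p) v Dv ∧
          MemLpLoc Ω ⊤ u ∧ MemLpLoc Ω ⊤ v ∧
          MemLpLoc Ω (ENNReal.ofReal (p / (p - 1))) (fun x => a x (Du x)) ∧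
          MemLpLoc Ω (ENNReal.ofReal (p / (p - 1))) (fun x => a x (Dv x))) ∧
        ((0 < σ ∧ σ ≤ 1 ∧ (∀ x ∈ Ω, StrictMono (f x))) ∨
          (1 ≤ σ ∧ σ ≤ max q 2 - 1 ∧
            (∀ x ∈ Ω, StrictMono (f x)) ∧ (∀ x ∈ Ω, StrictMono (g x))) ∨
          (max q 2 - 1 ≤ σ ∧ σ ≤ p - 1 ∧ (∀ x ∈ Ω, StrictMono (g x))) ∨
          (p - 1 ≤ σ ∧ σ ≤ p ∧ (∀ x ∈ Ω, StrictMono (g x)) ∧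
            ∃ C : ℝ, ∀ᵐ x ∂(volume.restrict Ω), u x - v x ≤ C))) ∨
      -- `u, v ∈ W^{1,∞}_loc`, the integrals in `Qu ≤ Qv` are well defined, and case A₄ holds
      ((MemW1Loc Ω ⊤ u Du ∧ MemW1Loc Ω ⊤ v Dv ∧
          MemLpLoc Ω 1 (fun x => a x (Du x)) ∧ MemLpLoc Ω 1 (fun x => a x (Dv x))) ∧
        (p ≤ σ ∧ (∀ x ∈ Ω, StrictMono (g x)))))
    (hQ : QLe Ω a (specialHamiltonian f g σ) u Du v Dv)
    (hbd : LeOnBoundary Ω u v) :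
    ∀ᵐ x ∂(volume.restrict Ω), u x ≤ v x := by
  have hmaxp : max 2 q ≤ p := max_le hp hqp
  have hmax2 : 2 ≤ max q 2 := le_max_right _ _
  have hmaxp' : max q 2 ≤ p := max_le hqp hp
  have hpmem : p ∈ Icc (max 2 q) p := ⟨hmaxp, le_rfl⟩
  -- the sign of `f x (v x) - f x (u x)`
  have hfsign : ∀ x ∈ Ω, ∀ s t k : ℝ, 0 < k → k ≤ s - t → f x t - f x s ≤ 0 :=
    fun x hx s t k hk hst => sub_nonpos.2 (hfm x hx (by linarith))
  rcases hcases with ⟨⟨hu, hv, hub, hvb, hau, hav⟩, hA⟩ | ⟨⟨hu, hv, hau, hav⟩, hσp, hgs⟩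
  · have hconj : Real.HolderConjugate p (p / (p - 1)) :=
      Real.HolderConjugate.conjExponent (by linarith)
    have hPP : ENNReal.HolderConjugate (ENNReal.ofReal (p / (p - 1))) (ENNReal.ofReal p) :=
      hconj.symm.ennrealOfReal
    -- Cases A₁ and A₂ₐ, with `r = p`: strictness of `f` supplies a term `-c`, which cancels the
    -- constant left by Young's inequality `C₀|Dw|^σ ≤ c + C₀ C₁|Dw|^p`.
    have hstrict : σ < p → (∀ x ∈ Ω, StrictMono (f x)) → 0 < σ →
        (σ ≤ 1 ∨ ∀ x ∈ Ω, StrictMono (g x)) → ∀ᵐ x ∂(volume.restrict Ω), u x ≤ v x := by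
      intro hσp hfs hσ hcase
      refine ae_le_of_specialHamiltonian hn hΩo hΩb hσ hae hf hg hgm hu hv hub hvb hau hav hcase
        (ENNReal.ofReal_le_ofReal hσp.le) hpmem le_rfl ?_ hQ hbd
      intro K hK hKΩ R k C₀ hk hC₀
      obtain ⟨c, hc, hgap⟩ := exists_uniform_gap_of_strictMono hf hfs hK hKΩ R hk
      obtain ⟨C₁, hC₁, hY⟩ := exists_rpow_mul_rpow_le (sub_pos.2 hσp) hσ (ε := c / C₀)
        (by positivity)
      refine ⟨C₀ * C₁, by positivity, ?_⟩
      filter_upwards [ae_restrict_mem hK.measurableSet] with x hx hxu hxv hkx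
      have h1 := hgap x hx _ _ hxu hxv hkx
      have h2 := hY 1 ‖Du x - Dv x‖ zero_le_one (norm_nonneg _)
      simp only [Real.one_rpow, one_mul, mul_one, sub_add_cancel] at h2
      have h3 : 0 ≤ ‖Du x - Dv x‖ ^ (p - 1) := Real.rpow_nonneg (norm_nonneg _) _
      calc f x (v x) - f x (u x) + C₀ * ‖Du x - Dv x‖ ^ σ
          ≤ -c + C₀ * (c / C₀ + C₁ * ‖Du x - Dv x‖ ^ p) := by
            gcongr
            linarith
        _ = C₀ * C₁ * ‖Du x - Dv x‖ ^ p := by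
            field_simp
            ring
        _ ≤ _ := by
            gcongr
            linarith
    rcases hA with ⟨hσ, hσ1, hfs⟩ | ⟨hσ1, hσq, hfs, hgs⟩ | ⟨hσq, hσp, hgs⟩ | ⟨hσp, hσp', hgs, -⟩
    · exact hstrict (by linarith) hfs hσ (Or.inl hσ1)
    · exact hstrict (by linarith) hfs (by linarith) (Or.inr hgs)
    -- Case A₂b: with `r = σ + 1` the power `σ` is exactly `r - 1`, and the range of `σ` is exactly
    -- the one making `r` admissible.
    · refine ae_le_of_specialHamiltonian hn hΩo hΩb (by linarith) hae hf hg hgm hu hv hub hvb hau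
        hav (Or.inr hgs) (ENNReal.ofReal_le_ofReal (by linarith)) (r := σ + 1)
        ⟨by rw [max_comm]; linarith, by linarith⟩ (ENNReal.ofReal_le_ofReal (by linarith)) ?_
        hQ hbd
      intro K hK hKΩ R k C₀ hk hC₀
      refine ⟨C₀, hC₀, ?_⟩
      filter_upwards [ae_restrict_mem hK.measurableSet] with x hx _ _ hkx
      have h1 := hfsign x (hKΩ hx) _ _ k hk hkx
      have h2 : 0 ≤ C₀ * ‖Du x - Dv x‖ ^ (σ + 1) := by positivity
      rw [add_sub_cancel_right]
      linarith
    -- Case A₃: `r = p`, and `σ` lies between `r - 1` and `r`.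
    · refine ae_le_of_specialHamiltonian hn hΩo hΩb (by linarith) hae hf hg hgm hu hv hub hvb hau
        hav (Or.inr hgs) (ENNReal.ofReal_le_ofReal hσp') hpmem le_rfl ?_ hQ hbd
      intro K hK hKΩ R k C₀ hk hC₀
      refine ⟨C₀, hC₀, ?_⟩
      filter_upwards [ae_restrict_mem hK.measurableSet] with x hx _ _ hkx
      have h1 := hfsign x (hKΩ hx) _ _ k hk hkx
      have h2 : ‖Du x - Dv x‖ ^ σ ≤ ‖Du x - Dv x‖ ^ (p - 1) + ‖Du x - Dv x‖ ^ p := by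
        have h0 := norm_nonneg (Du x - Dv x)
        have h3 := Real.rpow_nonneg h0 (p - 1)
        have h4 := Real.rpow_nonneg h0 p
        rcases le_total ‖Du x - Dv x‖ 1 with h | h
        · linarith [Real.rpow_le_rpow_of_exponent_ge' h0 h (by linarith : 0 ≤ p - 1) hσp]
        · linarith [Real.rpow_le_rpow_of_exponent_le h hσp']
      have h3 := mul_le_mul_of_nonneg_left h2 hC₀.le
      linarith
  -- Case A₄, with `P = ∞`, `P' = 1` and `r = p`: the gradients are bounded by `L` on `K`, so the
  -- excess power `σ - p` is absorbed into the constant.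
  · refine ae_le_of_specialHamiltonian hn hΩo hΩb (by linarith) hae hf hg hgm hu hv hu.memLp
      hv.memLp hau hav (Or.inr hgs) le_top hpmem le_top ?_ hQ hbd
    intro K hK hKΩ R k C₀ hk hC₀
    set L := (eLpNorm (fun x => Du x - Dv x) ⊤ (volume.restrict K)).toReal
    have hL := MemLp.ae_norm_le_toReal ((hu.memLp_grad K hK hKΩ).sub (hv.memLp_grad K hK hKΩ))
    refine ⟨C₀ * (L ^ (σ - p) + 1), by positivity, ?_⟩
    filter_upwards [ae_restrict_mem hK.measurableSet, hL] with x hx hxL _ _ hkx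
    have h1 := hfsign x (hKΩ hx) _ _ k hk hkx
    have h0 := norm_nonneg (Du x - Dv x)
    have h2 : ‖Du x - Dv x‖ ^ σ ≤ L ^ (σ - p) * ‖Du x - Dv x‖ ^ p := by
      conv_lhs => rw [← sub_add_cancel σ p]
      rw [Real.rpow_add_of_nonneg h0 (by linarith) (by linarith)]
      gcongr
      exact hxL
    have h3 := Real.rpow_nonneg h0 (p - 1)
    have h4 := Real.rpow_nonneg h0 p
    have hL0 : 0 ≤ L := ENNReal.toReal_nonneg
    have h5 : 0 ≤ L ^ (σ - p) := Real.rpow_nonneg hL0 _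
    calc f x (v x) - f x (u x) + C₀ * ‖Du x - Dv x‖ ^ σ
        ≤ 0 + C₀ * (L ^ (σ - p) * ‖Du x - Dv x‖ ^ p) := by gcongr
      _ ≤ C₀ * (L ^ (σ - p) + 1) * (‖Du x - Dv x‖ ^ (p - 1) + ‖Du x - Dv x‖ ^ p) := by
          rw [zero_add, mul_assoc]
          gcongr
          · linarith
          · linarith
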